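/- **Setting.** A full-duplex base station has $M\ge 2$ transmit and $N\ge 2$ receive antennas and $P\ge 0$ energy-harvesting antennas. The downlink and uplink channel vectors $\mathbf h_{td}\in\mathbb C^M$, $\mathbf h_{ur}\in\mathbb C^N$ have $M+N$ jointly independent $\mathcal{CN}(0,1)$ entries; the beamformers are $\mathbf w_{td}=\mathbf h_{td}/\|\mathbf h_{td}\|$, $\mathbf w_{ur}=\mathbf h_{ur}/\|\mathbf h_{ur}\|$; the self-interference matrix $\mathbf G_s\in\mathbb C^{M\times N}$ has all entries equal to a constant $g_s\in\mathbb C$. Let $P_u,\varphi_{ur},\sigma^2>0$, let $P_{RF},\varphi_{SI},\varphi_g,\zeta,\eta\ge 0$, let $g\in\mathbb C$, let $r_{sbs}>0$, and assume $\kappa:=\eta P\varphi_g|g|^2<1$. The uplink SINR is $$\gamma_{sbs}=\frac{\varphi_{ur}P_u\|\mathbf h_{ur}\|^2}{\varphi_{SI}(P_{EH}+P_{RF})\,\zeta\,|\mathbf w_{ur}^H\mathbf G_s^H\mathbf w_{td}|^2+\sigma^2},\qquad P_{EH}=\frac{\kappa P_{RF}z}{1-\kappa z},$$ where $z=\big|\sum_j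 w_{td,j}\big|^2$ in the energy-loop model; $\mathbb O_{sbs}$ is the event $\log_2(1+\gamma_{sbs})<r_{sbs}$ for the simplified model in which $z$ is replaced by $1$ in $P_{EH}$ (so that $P_{EH}+P_{RF}=P_{RF}/(1-\kappa)$). If $\kappa=0$ (for instance $P=0$), both choices of $z$ give the same outage event. **Theorem.** Let $$a_4=\frac{(2^{r_{sbs}}-1)\,\zeta|g_s|^2P_{RF}\varphi_{SI}}{P_u\varphi_{ur}(1-\kappa)},\qquad b_4=\frac{(2^{r_{sbs}}-1)\,\sigma^2}{P_u\varphi_{ur}},$$ and, for $0\le l\le i\le N-1$, $0\le p\le M+N-3$ and $u>-1$, let $$f_{i,l,p}(u)=e^{-\frac{a_4MN}{1+u}}(1+u)^{-3-i+l+N-p}\,{}_2F_1(N-1,N-1;M+N-2;-u),$$ where ${}_2F_1$ is the Gauss hypergeometric function (analytically continued to $(-\infty,1)$). Let $n\ge 1$, and let $L_n$ be the Laguerre polynomial with $L_n(0)=1$. Then $L_n$ has exactly $n$ distinct real roots $u_1,\dots,u_n$. Put $$w_s=\frac{u_s}{(n+1)^2[L_{n+1}(u_s)]^2},\qquad g_{i,l,p}(u)=e^uf_{i,l,p}(u),\qquad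 R_{i,l,p}(\xi)=\frac{(n!)^2}{(2n)!}\,g_{i,l,p}^{(2n)}(\xi).$$ Each $f_{i,l,p}$ is integrable on $(0,\infty)$, each $g_{i,l,p}$ is $2n$ times continuously differentiable there, and there are points $\xi_{i,l,p}\in(0,\infty)$ such that $$\int_0^\infty f_{i,l,p}(u)\,du=\sum_{s=1}^n w_s\,g_{i,l,p}(u_s)+R_{i,l,p}(\xi_{i,l,p})$$ for all such $i,l,p$, and $$\mathbb P\{\mathbb O_{sbs}\}=1-\beta(M-1,N-1)\sum_{i=0}^{N-1}\sum_{l=0}^{i}\sum_{p=0}^{M+N-3}\frac{b_4^l\,a_4^{i-l}(M-1)(N-1)}{i!\,e^{b_4}}(-1)^p\binom{M+N-3}{p}\binom il(MN)^{i-l}\Big(\sum_{s=1}^n w_s\,g_{i,l,p}(u_s)+R_{i,l,p}(\xi_{i,l,p})\Big),$$ where $\beta$ is the Beta function and $0^0=1$. -/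

import Mathlib

open MeasureTheory ProbabilityTheory
open scoped Matrix Polynomial

noncomputable section

namespace FullDuplex

/-! ### Special functions and Gauss–Laguerre quadrature -/

/-- `F` is the analytic continuation to the real half-line `(-∞, 1)` of the Gauss hypergeometric
series, i.e. the restriction of the principal branch on `ℂ ∖ [1, ∞)` to the real axis. By the
identity theorem its values on `(-∞, 1)` are determined by `a`, `b`, `c`. -/
def IsGaussHypergeometric (a b c : ℝ) (F : ℝ → ℝ) : Prop :=
  AnalyticOnNhd ℝ F (Set.Iio 1) ∧ ∀ x : ℝ, |x| < 1 → F x = ordinaryHypergeometric a b c x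

open Classical in
/-- The Gauss hypergeometric function `₂F₁(a, b; c; x)` for real `x < 1`: the power series on the
unit disk, and its analytic continuation elsewhere. -/
def gaussHypergeometric (a b c x : ℝ) : ℝ :=
  if h : ∃ F : ℝ → ℝ, IsGaussHypergeometric a b c F then h.choose x else 0

/-- The Laguerre polynomial `L_n`, normalised by `L_n(0) = 1`. -/
def laguerre (n : ℕ) : ℝ[X] :=
  ∑ k ∈ Finset.range (n + 1),
    Polynomial.C ((-1 : ℝ) ^ k * (n.choose k : ℝ) / (k.factorial : ℝ)) * Polynomial.X ^ k

/-- The nodes of the `n`-point Gauss–Laguerre rule: the real roots of `L_n`. -/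
def laguerreNodes (n : ℕ) : Finset ℝ := (laguerre n).roots.toFinset

/-- The weight of the `n`-point Gauss–Laguerre rule at the node `x`. -/
def laguerreWeight (n : ℕ) (x : ℝ) : ℝ :=
  x / (((n : ℝ) + 1) ^ 2 * ((laguerre (n + 1)).eval x) ^ 2)

/-- The `n`-point Gauss–Laguerre sum for `∫₀^∞ e^{-u} g(u) du`. -/
def gaussLaguerreSum (n : ℕ) (g : ℝ → ℝ) : ℝ :=
  ∑ x ∈ laguerreNodes n, laguerreWeight n x * g x

/-- The Lagrange form of the Gauss–Laguerre remainder, evaluated at the point `ξ`. -/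
def gaussLaguerreRemainder (n : ℕ) (g : ℝ → ℝ) (ξ : ℝ) : ℝ :=
  ((n.factorial : ℝ) ^ 2 / ((2 * n).factorial : ℝ)) * iteratedDeriv (2 * n) g ξ

/-! ### The full-duplex uplink -/

/-- The standard circularly symmetric complex Gaussian law `𝒞𝒩(0, 1)`: independent real and
imaginary parts, each centred Gaussian of variance `1 / 2`. -/
def stdComplexGaussian : Measure ℂ :=
  ((gaussianReal 0 (1 / 2)).prod (gaussianReal 0 (1 / 2))).map fun p : ℝ × ℝ => ⟨p.1, p.2⟩

/-- The physical parameters of the full-duplex system. -/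
structure Params where
  /-- transmit power of the base station drawn from the regular source -/
  pRF : ℝ
  /-- transmit power of the uplink device -/
  pU : ℝ
  /-- path gain of the uplink -/
  φur : ℝ
  /-- path gain of the self-interference link -/
  φSI : ℝ
  /-- path gain of the self-energy-recycling link -/
  φg : ℝ
  /-- self-interference cancellation coefficient -/
  ζ : ℝ
  /-- energy conversion efficiency -/
  η : ℝ
  /-- number of energy-harvesting antennas -/
  nEH : ℕ
  /-- channel coefficient of the self-energy-recycling link -/
  g : ℂ
  /-- common channel coefficient of the self-interference link -/
  gs : ℂ
  /-- noise standard deviation -/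
  σ : ℝ
  /-- uplink rate -/
  rate : ℝ

/-- The recycling coefficient `κ = η P φ_g |g|²`. -/
def Params.κ (S : Params) : ℝ := S.η * S.nEH * S.φg * ‖S.g‖ ^ 2

/-- The harvested power: the solution `p` of the energy loop `p = κ z (p + P_RF)`, where `z` is the
beamforming gain `|∑ w_td|²` seen by the recycling link. -/
def Params.harvestedPower (S : Params) (z : ℝ) : ℝ := S.κ * S.pRF * z / (1 - S.κ * z)

/-- The squared Euclidean norm of a channel vector. -/
def normSq {k : ℕ} (h : Fin k → ℂ) : ℝ := ∑ i, ‖h i‖ ^ 2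

/-- The MRT / MRC beamforming vector `h / ‖h‖`. -/
def beam {k : ℕ} (h : Fin k → ℂ) : Fin k → ℂ := fun i => h i / (Real.sqrt (normSq h) : ℂ)

/-- The gain `|∑ w_i|²` of the beamforming vector. -/
def beamGain {k : ℕ} (h : Fin k → ℂ) : ℝ := ‖∑ i, beam h i‖ ^ 2

/-- The near-field self-interference matrix, with equal and constant entries. -/
def Params.siMatrix (S : Params) (M N : ℕ) : Matrix (Fin M) (Fin N) ℂ := Matrix.of fun _ _ => S.gs

/-- The uplink SINR at the base station when the harvested power is `pEH`. -/
def Params.sinr (S : Params) {M N : ℕ} (pEH : ℝ) (htd : Fin M → ℂ) (hur : Fin N → ℂ) : ℝ :=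
  S.φur * S.pU * normSq hur /
    (S.φSI * (pEH + S.pRF) * S.ζ *
        ‖star (beam hur) ⬝ᵥ ((S.siMatrix M N)ᴴ *ᵥ beam htd)‖ ^ 2 + S.σ ^ 2)

/-- The uplink outage condition, for harvested power `pEH`. -/
def Params.Outage (S : Params) {M N : ℕ} (pEH : ℝ) (htd : Fin M → ℂ) (hur : Fin N → ℂ) : Prop :=
  Real.logb 2 (1 + S.sinr pEH htd hur) < S.rate

/-- The coefficient of `q` in the uplink outage threshold for `‖h_ur‖²`. -/
def Params.a₄ (S : Params) : ℝ :=
  ((2 : ℝ) ^ S.rate - 1) * S.ζ * ‖S.gs‖ ^ 2 * S.pRF * S.φSI / (S.pU * S.φur * (1 - S.κ))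

/-- The constant term of the uplink outage threshold for `‖h_ur‖²`. -/
def Params.b₄ (S : Params) : ℝ :=
  ((2 : ℝ) ^ S.rate - 1) * S.σ ^ 2 / (S.pU * S.φur)

/-- The integrand `f` of the outage formula. -/
def integrand (a : ℝ) (M N i l p : ℕ) (u : ℝ) : ℝ :=
  Real.exp (-(a * M * N / (1 + u))) * (1 + u) ^ (-3 - (i : ℤ) + l + N - p) *
    gaussHypergeometric ((N : ℝ) - 1) ((N : ℝ) - 1) ((M : ℝ) + N - 2) (-u)

/-- The function `u ↦ e^u f(u)` to which the Gauss–Laguerre rule is applied. -/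
def weightedIntegrand (a : ℝ) (M N i l p : ℕ) (u : ℝ) : ℝ :=
  Real.exp u * integrand a M N i l p u

end FullDuplex

end

/-!
The proof has a probabilistic half, which turns the outage probability into integrals of the
functions `f_{i,l,p}`, and an analytic half, which evaluates each of these integrals by
Gauss–Laguerre quadrature.

**The outage event.** All entries of the self-interference matrix are equal, so the interference
`|w_urᴴ G_sᴴ w_td|²` factors as `|g_s|²` times the product of the two beamforming gains
`|∑ w_ur|² |∑ w_td|²` (`norm_sq_selfInterference`), and outage means
`‖h_ur‖² < a₄ |∑ w_ur|² |∑ w_td|² + b₄` (`outage_iff`). A rotation of `ℂ^N` that takes the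
direction `(1, …, 1)` to a coordinate axis shows that `‖h_ur‖²` has the Gamma law of shape `N` and
is independent of `|∑ w_ur|² / N`, which has density `(N - 1) (1 - y)^{N - 2}` on `(0, 1)`
(`lintegral_normSq_beamGain`); likewise for `h_td`. The product `q` of the two normalised gains is
written as `q = 1 / (1 + u)`. Its density in `u` contains Euler's integral for
`₂F₁(N - 1, N - 1; M + N - 2; -u)` (`lintegral_product_density`,
`gaussHypergeometric_eq_eulerIntegral`), and the coverage probability is the integral of this
density against the survival function of the Gamma law at `a₄ M N / (1 + u) + b₄`
(`lintegral_coverage`). Expanding `(a₄ M N / (1 + u) + b₄)^i` and `(1 - 1 / (1 + u))^{M + N - 3}`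
by the binomial theorem gives the triple sum of the integrals of `f_{i,l,p}`
(`coverage_integrand_eq`, `integral_coverage`).

**The quadrature.** The polynomial `L_n` is orthogonal to lower degrees for the weight `e^{-u}` on
`(0, ∞)` (`expIntegral_laguerre_mul`). Hence it has no factor of positive degree that is
nonnegative there (`laguerre_ne_mul`), which excludes nonpositive roots, multiple roots and
irreducible factors without real roots: there are `n` simple roots, all positive. Orthogonality
also makes the interpolatory rule at these roots exact in degree less than `2 n` and identifies its
weights (`expIntegral_eq_sum_basis`, `expIntegral_basis_eq_laguerreWeight`). For a general `g` the
rule is applied to the Hermite interpolant of `g` at the nodes; the error of the interpolant at `u`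
is `g^{(2n)}(ξ_u) / (2n)!` times the square of the monic Laguerre polynomial
(`exists_hermite_error`). Integrating this error shows that a weighted mean of `g^{(2n)}` equals
`(2n)! / (n!)²` times the quadrature error, and a mean value argument replaces the mean by a single
value (`exists_gaussLaguerre_remainder`). The half-line and the possible growth of `g` do no harm,
since only the integrability of `e^{-u} g(u) = f(u)` is needed; it holds because Euler's integral
at `-u` is `O((1 + u)^{-(N - 2) - 1/2})` (`integrableOn_integrand`).
-/

namespace FullDuplex

/-! ### Laguerre polynomials -/

theorem integrableOn_exp_neg_mul_pow (k : ℕ) :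
    IntegrableOn (fun u : ℝ => Real.exp (-u) * u ^ k) (Set.Ioi 0) := by
  have h := Real.GammaIntegral_convergent (s := k + 1) (by positivity)
  refine h.congr_fun (fun u _ => ?_) measurableSet_Ioi
  simp

theorem integral_exp_neg_mul_pow (k : ℕ) :
    ∫ u in Set.Ioi (0 : ℝ), Real.exp (-u) * u ^ k = k.factorial := by
  rw [← Real.Gamma_nat_eq_factorial, Real.Gamma_eq_integral (by positivity)]
  refine setIntegral_congr_fun measurableSet_Ioi fun u _ => ?_
  simp

theorem integrableOn_exp_neg_mul_eval (p : ℝ[X]) :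
    IntegrableOn (fun u : ℝ => Real.exp (-u) * p.eval u) (Set.Ioi 0) := by
  simp_rw [Polynomial.eval_eq_sum_range, Finset.mul_sum]
  refine integrable_finsetSum _ fun k _ => ?_
  exact (((integrableOn_exp_neg_mul_pow k).const_mul (p.coeff k)).congr
    (.of_forall fun u => by ring))

/-- The functional `p ↦ ∫₀^∞ e^{-u} p(u) du` on polynomials, for which the Laguerre polynomials
are orthogonal. -/
noncomputable def expIntegral : ℝ[X] →ₗ[ℝ] ℝ where
  toFun p := ∫ u in Set.Ioi (0 : ℝ), Real.exp (-u) * p.eval u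
  map_add' p q := by
    simp_rw [Polynomial.eval_add, mul_add]
    exact integral_add (integrableOn_exp_neg_mul_eval p) (integrableOn_exp_neg_mul_eval q)
  map_smul' c p := by
    simp only [Polynomial.eval_smul, smul_eq_mul, RingHom.id_apply]
    rw [← integral_const_mul]
    exact integral_congr_ae (.of_forall fun u => by ring)

theorem expIntegral_apply (p : ℝ[X]) :
    expIntegral p = ∫ u in Set.Ioi (0 : ℝ), Real.exp (-u) * p.eval u := rfl

theorem expIntegral_X_pow (k : ℕ) : expIntegral (Polynomial.X ^ k) = k.factorial := by
  simp [expIntegral_apply, integral_exp_neg_mul_pow]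

theorem expIntegral_C_mul (c : ℝ) (p : ℝ[X]) :
    expIntegral (Polynomial.C c * p) = c * expIntegral p := by
  rw [← Polynomial.smul_eq_C_mul, map_smul, smul_eq_mul]

theorem coeff_laguerre (n k : ℕ) :
    (laguerre n).coeff k = (-1 : ℝ) ^ k * (n.choose k : ℝ) / (k.factorial : ℝ) := by
  simp only [laguerre, Polynomial.finsetSum_coeff, Polynomial.coeff_C_mul_X_pow]
  rw [Finset.sum_ite_eq]
  split_ifs with h
  · rfl
  · rw [Nat.choose_eq_zero_of_lt (by simpa using h)]; simp

theorem natDegree_laguerre (n : ℕ) : (laguerre n).natDegree = n := by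
  refine Polynomial.natDegree_eq_of_le_of_coeff_ne_zero ?_ ?_
  · rw [Polynomial.natDegree_le_iff_coeff_eq_zero]
    intro k hk
    rw [coeff_laguerre, Nat.choose_eq_zero_of_lt hk]; simp
  · rw [coeff_laguerre]; simp [Nat.factorial_ne_zero]

theorem leadingCoeff_laguerre (n : ℕ) :
    (laguerre n).leadingCoeff = (-1 : ℝ) ^ n / (n.factorial : ℝ) := by
  rw [Polynomial.leadingCoeff, natDegree_laguerre, coeff_laguerre]; simp

theorem laguerre_ne_zero (n : ℕ) : laguerre n ≠ 0 := by
  rw [← Polynomial.leadingCoeff_ne_zero, leadingCoeff_laguerre]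
  simp [Nat.factorial_ne_zero]

/-- The `n`-th finite difference of `x ↦ C(x, m)` at `m`, for `m ≤ n`. -/
theorem alternating_sum_choose_mul_choose {m n : ℕ} (h : m ≤ n) :
    ∑ k ∈ Finset.range (n + 1), (-1 : ℤ) ^ k * (n.choose k : ℤ) * ((m + k).choose m : ℤ) =
      if m = n then (-1) ^ n else 0 := by
  have key : (fwdDiff 1)^[n] (fun x : ℕ => (x.choose m : ℤ)) m = if m = n then 1 else 0 := by
    split_ifs with hmn
    · subst hmn
      have := congrFun (fwdDiff_iter_choose 0 m) m
      simpa using this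
    · obtain ⟨d, rfl⟩ := Nat.exists_eq_add_of_lt (lt_of_le_of_ne h hmn)
      have h0 : (fwdDiff 1)^[m] (fun x : ℕ => (x.choose m : ℤ)) = 
          fun x => ((x.choose 0 : ℕ) : ℤ) := by
        simpa using fwdDiff_iter_choose 0 m
      rw [show m + d + 1 = (d + 1) + m by ring, Function.iterate_add_apply, h0]
      have h1 : fwdDiff 1 (fun x : ℕ => ((x.choose 0 : ℕ) : ℤ)) = fun _ => 0 := by
        ext x; simp [fwdDiff]
      rw [Function.iterate_succ_apply, h1, fwdDiff_iter_eq_sum_shift]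
      simp
  rw [fwdDiff_iter_eq_sum_shift] at key
  have h2 : ∀ k ∈ Finset.range (n + 1),
      (-1 : ℤ) ^ k * (n.choose k : ℤ) * ((m + k).choose m : ℤ) =
        (-1) ^ n * (((-1 : ℤ) ^ (n - k) * (n.choose k : ℤ)) • ((m + k • 1).choose m : ℤ)) := by
    intro k hk
    have hk' : k ≤ n := by simpa [Nat.lt_succ_iff] using hk
    have h3 : (-1 : ℤ) ^ n * (-1) ^ (n - k) = (-1) ^ k := by
      rw [← pow_add, show n + (n - k) = k + 2 * (n - k) by omega, pow_add, pow_mul]; simp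
    rw [← h3]; simp only [smul_eq_mul, mul_one]; ring
  rw [Finset.sum_congr rfl h2, ← Finset.mul_sum, key]
  split_ifs <;> simp

theorem expIntegral_laguerre_mul_X_pow {m n : ℕ} (h : m ≤ n) :
    expIntegral (laguerre n * Polynomial.X ^ m) =
      if m = n then (-1) ^ n * (n.factorial : ℝ) else 0 := by
  have h1 : expIntegral (laguerre n * Polynomial.X ^ m) =
      m.factorial * ((∑ k ∈ Finset.range (n + 1),
        (-1 : ℤ) ^ k * (n.choose k : ℤ) * ((m + k).choose m : ℤ) : ℤ) : ℝ) := by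
    rw [laguerre, Finset.sum_mul, map_sum]
    push_cast
    rw [Finset.mul_sum]
    refine Finset.sum_congr rfl fun k _ => ?_
    rw [mul_assoc, ← pow_add, expIntegral_C_mul, expIntegral_X_pow]
    have h2 : ((m + k).choose m : ℝ) * m.factorial * k.factorial = (k + m).factorial := by
      rw [Nat.add_comm k m]
      rw [Nat.choose_symm_add]
      exact_mod_cast Nat.add_choose_mul_factorial_mul_factorial m k
    rw [← h2]
    have : (k.factorial : ℝ) ≠ 0 := by positivity
    field_simp
  rw [h1, alternating_sum_choose_mul_choose h]
  split_ifs with h3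
  · subst h3; push_cast; ring
  · simp

/-- Orthogonality of `L_n` to lower degrees, together with its pairing with degree `n`. -/
theorem expIntegral_laguerre_mul {n : ℕ} {p : ℝ[X]} (hp : p.natDegree ≤ n) :
    expIntegral (laguerre n * p) = p.coeff n * ((-1) ^ n * (n.factorial : ℝ)) := by
  conv_lhs => rw [p.as_sum_range_C_mul_X_pow' (Nat.lt_succ_of_le hp)]
  rw [Finset.mul_sum, map_sum]
  have : ∀ m ∈ Finset.range n.succ, expIntegral (laguerre n * (Polynomial.C (p.coeff m) *
      Polynomial.X ^ m)) = if m = n then p.coeff n * ((-1) ^ n * (n.factorial : ℝ)) else 0 := by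
    intro m hm
    rw [mul_left_comm, expIntegral_C_mul,
      expIntegral_laguerre_mul_X_pow (Nat.lt_succ_iff.1 (Finset.mem_range.1 hm))]
    split_ifs with h
    · rw [h]
    · simp
  rw [Finset.sum_congr rfl this]
  simp

theorem expIntegral_laguerre_mul_of_lt {n : ℕ} {p : ℝ[X]} (hp : p.degree < n) :
    expIntegral (laguerre n * p) = 0 := by
  rw [expIntegral_laguerre_mul (Polynomial.natDegree_le_of_degree_le hp.le),
    Polynomial.coeff_eq_zero_of_degree_lt hp, zero_mul]

theorem X_mul_derivative_laguerre (n : ℕ) :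
    Polynomial.X * Polynomial.derivative (laguerre (n + 1)) =
      Polynomial.C ((n : ℝ) + 1) * (laguerre (n + 1) - laguerre n) := by
  ext k
  rcases k with _ | k
  · simp [coeff_laguerre]
  · rw [Polynomial.coeff_X_mul, Polynomial.coeff_derivative, Polynomial.coeff_C_mul,
      Polynomial.coeff_sub, coeff_laguerre, coeff_laguerre]
    have h1 : ((n : ℝ) + 1) * (n.choose k : ℝ) = ((n + 1).choose (k + 1) : ℝ) * (k + 1) := by
      exact_mod_cast Nat.add_one_mul_choose_eq n k
    have h2 : ((n + 1).choose (k + 1) : ℝ) = n.choose k + n.choose (k + 1) := by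
      exact_mod_cast Nat.choose_succ_succ n k
    have h3 : (n.choose (k + 1) : ℝ) = ((n + 1).choose (k + 1) : ℝ) - n.choose k := by
      rw [h2]; ring
    rw [h3]
    linear_combination (-(-1 : ℝ) ^ (k + 1) / ((k + 1).factorial : ℝ)) * h1

/-- A second derivative relation, with `L_{n+1}` in place of `L_{n-1}`: at a root of `L_n` it turns
the derivative into `L_{n+1}`. -/
theorem X_mul_derivative_laguerre' (n : ℕ) :
    Polynomial.X * Polynomial.derivative (laguerre n) =
      Polynomial.C ((n : ℝ) + 1) * (laguerre (n + 1) - laguerre n) +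
        Polynomial.X * laguerre n := by
  ext k
  rcases k with _ | k
  · simp [coeff_laguerre]
  · rw [Polynomial.coeff_add, Polynomial.coeff_X_mul, Polynomial.coeff_derivative,
      Polynomial.coeff_C_mul, Polynomial.coeff_sub, Polynomial.coeff_X_mul]
    simp only [coeff_laguerre]
    have h1 : ((n : ℝ) + 1) * (n.choose k : ℝ) = ((n + 1).choose (k + 1) : ℝ) * (k + 1) := by
      exact_mod_cast Nat.add_one_mul_choose_eq n k
    have h2 : ((n + 1).choose (k + 1) : ℝ) = n.choose k + n.choose (k + 1) := by
      exact_mod_cast Nat.choose_succ_succ n k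
    have h3 : (n.choose (k + 1) : ℝ) = ((n + 1).choose (k + 1) : ℝ) - n.choose k := by
      rw [h2]; ring
    have h4 : ((k + 1).factorial : ℝ) = (k + 1) * k.factorial := by
      push_cast [Nat.factorial_succ]; ring
    have h5 : (k.factorial : ℝ) ≠ 0 := by positivity
    have h6 : (k : ℝ) + 1 ≠ 0 := by positivity
    rw [h3, h4]
    field_simp
    rw [pow_succ]
    linear_combination ((-1 : ℝ) ^ k) * h1

theorem ae_eval_ne_zero {p : ℝ[X]} (hp : p ≠ 0) : ∀ᵐ u : ℝ, p.eval u ≠ 0 := by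
  have : volume {u : ℝ | p.IsRoot u} = 0 := (Polynomial.finite_setOfPred_isRoot hp).measure_zero _
  filter_upwards [measure_eq_zero_iff_ae_notMem.1 this] with u hu using hu

theorem expIntegral_pos {p : ℝ[X]} (hp : p ≠ 0) (h : ∀ u : ℝ, 0 < u → 0 ≤ p.eval u) :
    0 < expIntegral p := by
  have hnn : 0 ≤ᵐ[volume.restrict (Set.Ioi (0 : ℝ))] fun u => Real.exp (-u) * p.eval u := by
    filter_upwards [ae_restrict_mem measurableSet_Ioi] with u hu
    exact mul_nonneg (Real.exp_pos _).le (h u hu)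
  refine lt_of_le_of_ne (integral_nonneg_of_ae hnn) fun h0 => ?_
  have h1 := (integral_eq_zero_iff_of_nonneg_ae hnn (integrableOn_exp_neg_mul_eval p)).1 h0.symm
  have h2 : ∀ᵐ u ∂(volume.restrict (Set.Ioi (0 : ℝ))), False := by
    filter_upwards [h1, ae_restrict_of_ae (ae_eval_ne_zero hp)] with u hu hu'
    exact (mul_ne_zero (Real.exp_pos _).ne' hu') hu
  rw [Filter.eventually_false_iff_eq_bot, ae_eq_bot, Measure.restrict_eq_zero] at h2
  simp at h2

/-- `L_n` has no factor of positive degree that is nonnegative on `(0, ∞)`: a cofactor `r` of such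
a factor `q` would have degree less than `n` and yet `∫ e^{-u} L_n r = ∫ e^{-u} q r² > 0`. -/
theorem laguerre_ne_mul {n : ℕ} {q r : ℝ[X]} (hq : 0 < q.natDegree)
    (h : ∀ u : ℝ, 0 < u → 0 ≤ q.eval u) : laguerre n ≠ q * r := by
  intro hL
  have hq0 : q ≠ 0 := by rintro rfl; simp at hq
  have hr0 : r ≠ 0 := by rintro rfl; exact laguerre_ne_zero n (by simpa using hL)
  have hdeg : q.natDegree + r.natDegree = n := by
    rw [← Polynomial.natDegree_mul hq0 hr0, ← hL, natDegree_laguerre]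
  have h1 : expIntegral (laguerre n * r) = 0 := by
    apply expIntegral_laguerre_mul_of_lt
    rw [Polynomial.degree_eq_natDegree hr0]
    exact_mod_cast (by omega : r.natDegree < n)
  have h2 : 0 < expIntegral (q * r ^ 2) := by
    refine expIntegral_pos (mul_ne_zero hq0 (pow_ne_zero _ hr0)) fun u hu => ?_
    rw [Polynomial.eval_mul, Polynomial.eval_pow]
    exact mul_nonneg (h u hu) (sq_nonneg _)
  rw [hL, mul_assoc, ← sq] at h1
  exact h2.ne' h1

theorem pos_of_isRoot_laguerre {n : ℕ} {a : ℝ} (h : (laguerre n).IsRoot a) : 0 < a := by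
  by_contra ha
  obtain ⟨r, hr⟩ := Polynomial.dvd_iff_isRoot.2 h
  refine laguerre_ne_mul (by simp) (fun u hu => ?_) hr
  simp only [Polynomial.eval_sub, Polynomial.eval_X, Polynomial.eval_C]
  linarith

theorem nodup_roots_laguerre (n : ℕ) : (laguerre n).roots.Nodup := by
  rw [Multiset.nodup_iff_count_le_one]
  intro a
  rw [Polynomial.count_roots]
  by_contra! h
  obtain ⟨r, hr⟩ := (Polynomial.le_rootMultiplicity_iff (laguerre_ne_zero n)).1 h
  refine laguerre_ne_mul (by simp) (fun u hu => ?_) hr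
  rw [Polynomial.eval_pow]
  exact sq_nonneg _

/-- An irreducible factor of degree other than one would have constant sign on `ℝ`, contrary to
`laguerre_ne_mul`. -/
theorem splits_laguerre (n : ℕ) : (laguerre n).Splits := by
  obtain ⟨v, hv⟩ := UniqueFactorizationMonoid.factors_prod (laguerre_ne_zero n)
  rw [← hv]
  refine (Polynomial.Splits.multisetProd fun g hg' => ?_).mul v.isUnit.splits
  have hg := UniqueFactorizationMonoid.irreducible_of_factor g hg'
  obtain ⟨r, hr⟩ := UniqueFactorizationMonoid.dvd_of_mem_factors hg'
  refine Polynomial.Splits.of_degree_eq_one ?_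
  have h1 : g.natDegree ≠ 0 := hg.natDegree_pos.ne'
  by_contra h2
  -- an irreducible real polynomial of degree other than one has no zero, hence a constant sign
  have hroot : ∀ x, g.eval x ≠ 0 := fun x hx =>
    h2 (Polynomial.degree_eq_one_of_irreducible_of_root hg hx)
  have hsign : (∀ x, 0 < g.eval x) ∨ ∀ x, g.eval x < 0 := by
    by_contra! h
    obtain ⟨⟨x, hx⟩, y, hy⟩ := h
    obtain ⟨z, hz⟩ := mem_range_of_exists_le_of_exists_ge g.continuous ⟨x, hx⟩ ⟨y, hy⟩
    exact hroot z hz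
  rcases hsign with h | h
  · exact laguerre_ne_mul (Nat.pos_of_ne_zero h1) (fun u _ => (h u).le) hr
  · refine laguerre_ne_mul (q := -g) (r := -r) (by simpa using Nat.pos_of_ne_zero h1)
      (fun u _ => ?_) (by simpa using hr)
    rw [Polynomial.eval_neg]; linarith [h u]

theorem card_laguerreNodes (n : ℕ) : (laguerreNodes n).card = n := by
  rw [laguerreNodes, Multiset.toFinset_card_of_nodup (nodup_roots_laguerre n),
    ← (splits_laguerre n).natDegree_eq_card_roots, natDegree_laguerre]

theorem mem_laguerreNodes {n : ℕ} {x : ℝ} : x ∈ laguerreNodes n ↔ (laguerre n).eval x = 0 := by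
  simp [laguerreNodes, laguerre_ne_zero]

theorem pos_of_mem_laguerreNodes {n : ℕ} {x : ℝ} (h : x ∈ laguerreNodes n) : 0 < x :=
  pos_of_isRoot_laguerre (mem_laguerreNodes.1 h)

/-! ### Gauss–Laguerre quadrature of polynomials -/

/-- The monic Laguerre polynomial, as the nodal polynomial of the quadrature nodes. -/
noncomputable def laguerreNodal (n : ℕ) : ℝ[X] := Lagrange.nodal (laguerreNodes n) id

theorem laguerre_eq_C_mul_nodal (n : ℕ) :
    laguerre n = Polynomial.C ((-1 : ℝ) ^ n / (n.factorial : ℝ)) * laguerreNodal n := by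
  conv_lhs => rw [(splits_laguerre n).eq_prod_roots, leadingCoeff_laguerre]
  rw [laguerreNodal, Lagrange.nodal, Finset.prod_eq_multiset_prod, laguerreNodes,
    Multiset.toFinset_val, (nodup_roots_laguerre n).dedup]
  rfl

theorem laguerreNodal_eq_C_mul (n : ℕ) :
    laguerreNodal n = Polynomial.C ((-1 : ℝ) ^ n * (n.factorial : ℝ)) * laguerre n := by
  rw [laguerre_eq_C_mul_nodal, ← mul_assoc, ← Polynomial.C_mul]
  have : (n.factorial : ℝ) ≠ 0 := by positivity
  have h2 : (-1 : ℝ) ^ n * n.factorial * ((-1) ^ n / n.factorial) = 1 := by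
    field_simp
    rw [← pow_mul, mul_comm, pow_mul]; simp
  rw [h2]; simp

theorem natDegree_laguerreNodal (n : ℕ) : (laguerreNodal n).natDegree = n := by
  rw [laguerreNodal, Lagrange.natDegree_nodal, card_laguerreNodes]

theorem monic_laguerreNodal (n : ℕ) : (laguerreNodal n).Monic := Lagrange.nodal_monic

theorem expIntegral_laguerreNodal_sq (n : ℕ) :
    expIntegral (laguerreNodal n ^ 2) = (n.factorial : ℝ) ^ 2 := by
  have h1 : (laguerreNodal n).coeff n = 1 := by
    have := monic_laguerreNodal n
    rwa [Polynomial.Monic, Polynomial.leadingCoeff, natDegree_laguerreNodal] at this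
  rw [sq]
  nth_rewrite 1 [laguerreNodal_eq_C_mul]
  rw [mul_assoc, expIntegral_C_mul, expIntegral_laguerre_mul (natDegree_laguerreNodal n).le, h1]
  have : ((-1 : ℝ) ^ n) ^ 2 = 1 := by rw [← pow_mul, mul_comm, pow_mul]; simp
  linear_combination (n.factorial : ℝ) ^ 2 * this

/-- The quadrature rule with interpolatory weights is exact in degree less than `2 n`. -/
theorem expIntegral_eq_sum_basis {n : ℕ} {p : ℝ[X]} (hp : p.natDegree < 2 * n) :
    expIntegral p = ∑ x ∈ laguerreNodes n,
      expIntegral (Lagrange.basis (laguerreNodes n) id x) * p.eval x := by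
  have hmon := monic_laguerreNodal n
  have hdiv : expIntegral (laguerreNodal n * (p /ₘ laguerreNodal n)) = 0 := by
    rw [laguerreNodal_eq_C_mul, mul_assoc, expIntegral_C_mul, ← laguerreNodal_eq_C_mul,
      expIntegral_laguerre_mul_of_lt, mul_zero]
    refine lt_of_le_of_lt Polynomial.degree_le_natDegree ?_
    rw [Polynomial.natDegree_divByMonic _ hmon, natDegree_laguerreNodal]
    exact_mod_cast (by omega : p.natDegree - n < n)
  have hr : p %ₘ laguerreNodal n = ∑ x ∈ laguerreNodes n,
      Polynomial.C (p.eval x) * Lagrange.basis (laguerreNodes n) id x := by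
    rw [← Lagrange.interpolate_apply (laguerreNodes n) id (fun x => p.eval x)]
    refine Lagrange.eq_interpolate_of_eval_eq _ Function.injective_id.injOn ?_ fun x hx => ?_
    · rw [← Lagrange.degree_nodal (v := (id : ℝ → ℝ))]
      exact Polynomial.degree_modByMonic_lt _ hmon
    · have h0 : (laguerreNodal n).eval (id x) = 0 := Lagrange.eval_nodal_at_node hx
      have h1 := congrArg (Polynomial.eval (id x))
        (Polynomial.modByMonic_add_div p (laguerreNodal n))
      rw [Polynomial.eval_add, Polynomial.eval_mul, h0, zero_mul, add_zero] at h1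
      exact h1
  conv_lhs => rw [← Polynomial.modByMonic_add_div p (laguerreNodal n)]
  rw [map_add, hdiv, add_zero, hr, map_sum]
  exact Finset.sum_congr rfl fun x _ => by rw [expIntegral_C_mul, mul_comm]

/-- The interpolatory weight at the node `x` is `x / ((n + 1) L_{n+1}(x))²`: the cofactor of `X - x`
in the monic Laguerre polynomial is paired with `L_{n-1}`, once by orthogonality and once by
quadrature, where only the node `x` contributes. -/
theorem expIntegral_basis_eq_laguerreWeight {n : ℕ} {x : ℝ} (hx : x ∈ laguerreNodes n) :
    expIntegral (Lagrange.basis (laguerreNodes n) id x) = laguerreWeight n x := by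
  obtain ⟨m, rfl⟩ : ∃ m, n = m + 1 := by
    refine Nat.exists_eq_succ_of_ne_zero fun h => ?_
    subst h
    have := card_laguerreNodes 0
    rw [Finset.card_eq_zero] at this
    simp [this] at hx
  set w := expIntegral (Lagrange.basis (laguerreNodes (m + 1)) id x) with hw
  set q : ℝ[X] := Lagrange.nodal ((laguerreNodes (m + 1)).erase x) id with hq
  have hqdeg : q.natDegree = m := by
    rw [hq, Lagrange.natDegree_nodal, Finset.card_erase_of_mem hx, card_laguerreNodes]; simp
  have hqcoeff : q.coeff m = 1 := by
    have := Lagrange.nodal_monic (s := (laguerreNodes (m + 1)).erase x) (v := id)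
    rwa [Polynomial.Monic, Polynomial.leadingCoeff, ← hq, hqdeg] at this
  have e1 : expIntegral (laguerre m * q) = (-1) ^ m * (m.factorial : ℝ) := by
    rw [expIntegral_laguerre_mul hqdeg.le, hqcoeff, one_mul]
  have e2 : expIntegral (laguerre m * q) = w * ((laguerre m).eval x * q.eval x) := by
    rw [expIntegral_eq_sum_basis (n := m + 1), Finset.sum_eq_single x]
    · rw [Polynomial.eval_mul]
    · intro y hy hyx
      have : q.eval (id y) = 0 := Lagrange.eval_nodal_at_node (Finset.mem_erase.2 ⟨hyx, hy⟩)
      rw [Polynomial.eval_mul, show q.eval y = 0 from this]; simp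
    · exact fun h => absurd hx h
    · refine lt_of_le_of_lt Polynomial.natDegree_mul_le ?_
      rw [hqdeg, natDegree_laguerre]; omega
  have hqx : q.eval x =
      (-1) ^ (m + 1) * ((m + 1).factorial : ℝ) * (laguerre (m + 1)).derivative.eval x := by
    have h1 := Lagrange.eval_nodal_derivative_eval_node_eq (v := id) hx
    rw [← hq, ← laguerreNodal, laguerreNodal_eq_C_mul, Polynomial.derivative_C_mul,
      Polynomial.eval_C_mul] at h1
    exact h1.symm
  have hx0 := (pos_of_mem_laguerreNodes hx).ne'
  have hroot := mem_laguerreNodes.1 hx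
  have r1 := congrArg (Polynomial.eval x) (X_mul_derivative_laguerre m)
  have r2 := congrArg (Polynomial.eval x) (X_mul_derivative_laguerre' (m + 1))
  simp only [Polynomial.eval_mul, Polynomial.eval_X, Polynomial.eval_C, Polynomial.eval_sub,
    Polynomial.eval_add, hroot] at r1 r2
  set D := (laguerre (m + 1)).derivative.eval x
  have hm : (m.factorial : ℝ) ≠ 0 := by positivity
  have hmm : ((m + 1).factorial : ℝ) = (m + 1) * m.factorial := by
    push_cast [Nat.factorial_succ]; ring
  have key : w * x * D ^ 2 = 1 := by
    have h3 := e2.symm.trans e1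
    rw [hqx, hmm] at h3
    have hs : ((-1 : ℝ) ^ m) ^ 2 = 1 := by rw [← pow_mul, mul_comm, pow_mul]; simp
    have h4 : (m.factorial : ℝ) * (w * x * D ^ 2) = m.factorial * 1 := by
      rw [pow_succ] at h3
      linear_combination (-1 : ℝ) ^ m * h3 + w * D * m.factorial * r1 +
        (m.factorial + ((m : ℝ) + 1) * m.factorial * w * D * (laguerre m).eval x) * hs
    exact mul_left_cancel₀ hm h4
  have hD : D ≠ 0 := by rintro h; rw [h] at key; simp at key
  have hL : ((((m + 1 : ℕ) : ℝ) + 1) * (laguerre (m + 1 + 1)).eval x) ^ 2 = (x * D) ^ 2 := by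
    rw [r2]; ring
  rw [laguerreWeight, ← mul_pow, hL, mul_pow, eq_div_iff (by positivity)]
  linear_combination x * key

theorem gaussLaguerreSum_eval {n : ℕ} {p : ℝ[X]} (hp : p.natDegree < 2 * n) :
    gaussLaguerreSum n (fun u => p.eval u) = expIntegral p := by
  rw [expIntegral_eq_sum_basis hp, gaussLaguerreSum]
  exact Finset.sum_congr rfl fun x hx => by rw [expIntegral_basis_eq_laguerreWeight hx]

/-! ### The Gauss–Laguerre remainder -/

/-- Rolle's theorem between consecutive members of a finite set of zeros. -/
theorem exists_finset_zeros_deriv {f : ℝ → ℝ} {I : Set ℝ} (hI : I.OrdConnected)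
    (hf : ContinuousOn f I) {S : Finset ℝ} {m : ℕ} (hS : S.card = m + 1) (hSI : ↑S ⊆ I)
    (hz : ∀ x ∈ S, f x = 0) :
    ∃ T : Finset ℝ, T.card = m ∧ ↑T ⊆ I ∧ Disjoint T S ∧ ∀ x ∈ T, deriv f x = 0 := by
  set s := S.orderEmbOfFin hS with hs
  have hmem : ∀ k, s k ∈ S := fun k => Finset.orderEmbOfFin_mem S hS k
  have hlt : ∀ i : Fin m, s i.castSucc < s i.succ := fun i =>
    s.strictMono (Fin.castSucc_lt_succ)
  have hIcc : ∀ i : Fin m, Set.Icc (s i.castSucc) (s i.succ) ⊆ I := fun i =>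
    hI.out (hSI (hmem _)) (hSI (hmem _))
  have hex : ∀ i : Fin m, ∃ c ∈ Set.Ioo (s i.castSucc) (s i.succ), deriv f c = 0 := fun i =>
    exists_deriv_eq_zero (hlt i) (hf.mono (hIcc i)) (by rw [hz _ (hmem _), hz _ (hmem _)])
  choose c hc hc0 using hex
  have hmono : StrictMono c := by
    intro i j hij
    calc c i < s i.succ := (hc i).2
      _ ≤ s j.castSucc := s.monotone (by rw [Fin.le_def]; simpa using hij)
      _ < c j := (hc j).1
  refine ⟨Finset.univ.image c, ?_, ?_, ?_, ?_⟩
  · rw [Finset.card_image_of_injective _ hmono.injective, Finset.card_fin]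
  · intro x hx
    obtain ⟨i, -, rfl⟩ := Finset.mem_image.1 (Finset.mem_coe.1 hx)
    exact hIcc i (Set.Ioo_subset_Icc_self (hc i))
  · rw [Finset.disjoint_left]
    intro x hx hxS
    obtain ⟨i, -, rfl⟩ := Finset.mem_image.1 hx
    have : c i ∈ Set.range s := by rw [hs, Finset.range_orderEmbOfFin]; exact hxS
    obtain ⟨k, hk⟩ := this
    have h1 := (hc i).1
    have h2 := (hc i).2
    rw [← hk, s.lt_iff_lt, Fin.lt_def] at h1 h2
    simp at h1 h2
    omega
  · intro x hx
    obtain ⟨i, -, rfl⟩ := Finset.mem_image.1 hx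
    exact hc0 i

theorem exists_iteratedDeriv_eq_zero {I : Set ℝ} (hI : I.OrdConnected) (hIo : IsOpen I) {k : ℕ}
    {f : ℝ → ℝ} (hf : ContDiffOn ℝ (k : WithTop ℕ∞) f I) {S : Finset ℝ} (hS : S.card = k + 1)
    (hSI : ↑S ⊆ I) (hz : ∀ x ∈ S, f x = 0) : ∃ x ∈ I, iteratedDeriv k f x = 0 := by
  induction k generalizing f S with
  | zero =>
    obtain ⟨x, hx⟩ := Finset.card_pos.1 (by omega : 0 < S.card)
    exact ⟨x, hSI hx, by simpa using hz x hx⟩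
  | succ k ih =>
    obtain ⟨T, hT, hTI, -, hT0⟩ := exists_finset_zeros_deriv hI hf.continuousOn hS hSI hz
    have hd := ((contDiffOn_succ_iff_deriv_of_isOpen (n := (k : WithTop ℕ∞)) hIo).1
      (by exact_mod_cast hf)).2.2
    obtain ⟨x, hx, hx0⟩ := ih hd hT hTI hT0
    exact ⟨x, hx, by rw [iteratedDeriv_succ']; exact hx0⟩

/-- Rolle's theorem for `n` double zeros and one further zero. -/
theorem exists_iteratedDeriv_eq_zero_of_double_zeros {I : Set ℝ} (hI : I.OrdConnected)
    (hIo : IsOpen I) {n : ℕ} (hn : 1 ≤ n) {f : ℝ → ℝ}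
    (hf : ContDiffOn ℝ ((2 * n : ℕ) : WithTop ℕ∞) f I) {S : Finset ℝ} (hS : S.card = n)
    (hSI : ↑S ⊆ I) (hz : ∀ x ∈ S, f x = 0) (hz' : ∀ x ∈ S, deriv f x = 0) {u : ℝ} (hu : u ∈ I)
    (huS : u ∉ S) (hfu : f u = 0) : ∃ x ∈ I, iteratedDeriv (2 * n) f x = 0 := by
  obtain ⟨k, hk⟩ : ∃ k, 2 * n = k + 1 := ⟨2 * n - 1, by omega⟩
  obtain ⟨T, hT, hTI, hTS, hT0⟩ := exists_finset_zeros_deriv (S := insert u S) (m := n) hI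
    hf.continuousOn (by rw [Finset.card_insert_of_notMem huS, hS])
    (by rw [Finset.coe_insert]; exact Set.insert_subset hu hSI)
    (by intro x hx; rcases Finset.mem_insert.1 hx with rfl | h; exacts [hfu, hz x h])
  rw [hk] at hf ⊢
  have hd := ((contDiffOn_succ_iff_deriv_of_isOpen (n := (k : WithTop ℕ∞)) hIo).1
    (by exact_mod_cast hf)).2.2
  have hdisj : Disjoint T S := hTS.mono_right (Finset.subset_insert _ _)
  obtain ⟨x, hx, hx0⟩ := exists_iteratedDeriv_eq_zero hI hIo hd (S := T ∪ S)
    (by rw [Finset.card_union_of_disjoint hdisj, hT, hS]; omega)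
    (by rw [Finset.coe_union]; exact Set.union_subset hTI hSI)
    (by intro x hx; rcases Finset.mem_union.1 hx with h | h; exacts [hT0 x h, hz' x h])
  exact ⟨x, hx, by rw [iteratedDeriv_succ']; exact hx0⟩

/-- Hermite interpolation: the Lagrange interpolant, corrected by a multiple of the nodal
polynomial to match the derivatives. -/
theorem exists_hermite_interpolant {S : Finset ℝ} (hS : S.Nonempty) (a b : ℝ → ℝ) :
    ∃ H : ℝ[X], H.natDegree < 2 * S.card ∧
      ∀ x ∈ S, H.eval x = a x ∧ H.derivative.eval x = b x := by
  set P := Lagrange.nodal S (id : ℝ → ℝ) with hP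
  set A := Lagrange.interpolate S id a with hA
  set B := Lagrange.interpolate S id
    (fun x => (b x - A.derivative.eval x) / P.derivative.eval x) with hB
  have hinj : Set.InjOn (id : ℝ → ℝ) S := Function.injective_id.injOn
  have hlt : ∀ r, (Lagrange.interpolate S id r : ℝ[X]).natDegree < S.card := by
    intro r
    by_cases h0 : (Lagrange.interpolate S id r : ℝ[X]) = 0
    · rw [h0]; simpa using hS
    · rw [Polynomial.natDegree_lt_iff_degree_lt h0]
      exact Lagrange.degree_interpolate_lt r hinj
  refine ⟨A + P * B, ?_, fun x hx => ?_⟩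
  · refine lt_of_le_of_lt (Polynomial.natDegree_add_le _ _) (max_lt ?_ ?_)
    · exact (hlt a).trans_le (by omega)
    · refine lt_of_le_of_lt Polynomial.natDegree_mul_le ?_
      have := hlt (fun x => (b x - A.derivative.eval x) / P.derivative.eval x)
      rw [hP, Lagrange.natDegree_nodal]
      rw [← hB] at this
      omega
  · have hPx : P.eval x = 0 := Lagrange.eval_nodal_at_node (v := id) hx
    have hP'x : P.derivative.eval x ≠ 0 := by
      have h1 := Lagrange.nodalWeight_ne_zero hinj hx
      rw [Lagrange.nodalWeight_eq_eval_derivative_nodal hx] at h1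
      exact fun h => h1 (by rw [inv_eq_zero]; exact h)
    have hAx : A.eval x = a x := Lagrange.eval_interpolate_at_node a hinj hx
    have hBx : B.eval x = (b x - A.derivative.eval x) / P.derivative.eval x :=
      Lagrange.eval_interpolate_at_node _ hinj hx
    constructor
    · simp [hPx, hAx]
    · simp only [Polynomial.derivative_add, Polynomial.derivative_mul, Polynomial.eval_add,
        Polynomial.eval_mul, hPx, hBx]
      field_simp
      ring

theorem contDiff_eval (p : ℝ[X]) (k : WithTop ℕ∞) : ContDiff ℝ k fun u => p.eval u := by
  simpa [Polynomial.coe_aeval_eq_eval] using p.contDiff_aeval (𝕜 := ℝ) k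

theorem iteratedDeriv_eval (p : ℝ[X]) (k : ℕ) :
    iteratedDeriv k (fun u => p.eval u) = fun u => (Polynomial.derivative^[k] p).eval u := by
  induction k generalizing p with
  | zero => simp
  | succ k ih =>
    rw [iteratedDeriv_succ']
    have : deriv (fun u => p.eval u) = fun u => p.derivative.eval u := by
      ext u; exact p.deriv
    rw [this, ih, Function.iterate_succ_apply]

theorem iteratedDeriv_eval_of_natDegree_le {p : ℝ[X]} {k : ℕ} (hp : p.natDegree ≤ k) (u : ℝ) :
    iteratedDeriv k (fun u => p.eval u) u = k.factorial * p.coeff k := by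
  rw [iteratedDeriv_eval]
  have h : (Polynomial.derivative^[k] p).natDegree ≤ 0 :=
    (Polynomial.natDegree_iterate_derivative p k).trans (by omega)
  rw [Polynomial.eq_C_of_natDegree_le_zero h]
  simp [Polynomial.coeff_iterate_derivative, Nat.descFactorial_self]

/-- The pointwise error of Hermite interpolation at the Laguerre nodes. -/
theorem exists_hermite_error {n : ℕ} (hn : 1 ≤ n) {g : ℝ → ℝ}
    (hg : ContDiffOn ℝ ((2 * n : ℕ) : WithTop ℕ∞) g (Set.Ioi 0)) {H : ℝ[X]}
    (hH : H.natDegree < 2 * n)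
    (hHg : ∀ x ∈ laguerreNodes n, H.eval x = g x ∧ H.derivative.eval x = deriv g x)
    {u : ℝ} (hu : 0 < u) (hu' : u ∉ laguerreNodes n) :
    ∃ ξ : ℝ, 0 < ξ ∧ g u - H.eval u =
      iteratedDeriv (2 * n) g ξ / ((2 * n).factorial : ℝ) * (laguerreNodal n).eval u ^ 2 := by
  have hPu : (laguerreNodal n).eval u ≠ 0 := by
    rw [laguerreNodal_eq_C_mul, Polynomial.eval_C_mul]
    have : (n.factorial : ℝ) ≠ 0 := by positivity
    have h2 := mem_laguerreNodes.not.1 hu'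
    positivity
  set K : ℝ := (g u - H.eval u) / (laguerreNodal n).eval u ^ 2 with hK
  set P : ℝ[X] := H + Polynomial.C K * laguerreNodal n ^ 2 with hP
  have hsqdeg : (laguerreNodal n ^ 2).natDegree = 2 * n := by
    rw [Polynomial.natDegree_pow, natDegree_laguerreNodal]
  have hPdeg : P.natDegree ≤ 2 * n :=
    (Polynomial.natDegree_add_le _ _).trans
      (max_le hH.le ((Polynomial.natDegree_C_mul_le _ _).trans hsqdeg.le))
  have hPcoeff : P.coeff (2 * n) = K := by
    have h1 := (monic_laguerreNodal n).pow 2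
    rw [Polynomial.Monic, Polynomial.leadingCoeff, hsqdeg] at h1
    rw [hP, Polynomial.coeff_add, Polynomial.coeff_C_mul, h1,
      Polynomial.coeff_eq_zero_of_natDegree_lt hH]
    ring
  have hdiff : ∀ x : ℝ, 0 < x → DifferentiableAt ℝ g x := fun x hx =>
    (hg.contDiffAt (Ioi_mem_nhds hx)).differentiableAt (by
      have : 2 * n ≠ 0 := by omega
      exact_mod_cast this)
  have hPn : ∀ x ∈ laguerreNodes n, (laguerreNodal n).eval x = 0 := fun x hx =>
    Lagrange.eval_nodal_at_node (v := id) hx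
  obtain ⟨ξ, hξ, hξ0⟩ := exists_iteratedDeriv_eq_zero_of_double_zeros (I := Set.Ioi 0)
    Set.ordConnected_Ioi isOpen_Ioi hn (f := g - fun t => P.eval t)
    (hg.sub (contDiff_eval P _).contDiffOn) (card_laguerreNodes n)
    (fun x hx => pos_of_mem_laguerreNodes hx)
    (by
      intro x hx
      simp [hP, hPn x hx, (hHg x hx).1])
    (by
      intro x hx
      rw [deriv_sub (hdiff x (pos_of_mem_laguerreNodes hx)) P.differentiableAt, Polynomial.deriv]
      simp [hP, hPn x hx, (hHg x hx).2, Polynomial.derivative_pow])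
    (u := u) hu hu' (by
      simp only [Pi.sub_apply, hP, hK, Polynomial.eval_add, Polynomial.eval_mul, Polynomial.eval_C,
        Polynomial.eval_pow]
      field_simp
      ring)
  refine ⟨ξ, hξ, ?_⟩
  rw [iteratedDeriv_sub (hg.contDiffAt (Ioi_mem_nhds hξ)) (contDiff_eval P _).contDiffAt,
    iteratedDeriv_eval_of_natDegree_le hPdeg, hPcoeff] at hξ0
  have h1 : iteratedDeriv (2 * n) g ξ / ((2 * n).factorial : ℝ) = K := by
    have : ((2 * n).factorial : ℝ) ≠ 0 := by positivity
    field_simp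
    linarith
  rw [h1, hK]
  field_simp

/-- **Gauss–Laguerre quadrature with Lagrange remainder**, for integrands of any growth that the
weight makes integrable. The Hermite error is integrated; the mean value of `g^{(2n)}` so obtained
is a value of `g^{(2n)}` because these form an interval. -/
theorem exists_gaussLaguerre_remainder {n : ℕ} (hn : 1 ≤ n) {g : ℝ → ℝ}
    (hg : ContDiffOn ℝ ((2 * n : ℕ) : WithTop ℕ∞) g (Set.Ioi 0))
    (hint : IntegrableOn (fun u => Real.exp (-u) * g u) (Set.Ioi 0)) :
    ∃ ξ : ℝ, 0 < ξ ∧ ∫ u in Set.Ioi (0 : ℝ), Real.exp (-u) * g u =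
      gaussLaguerreSum n g + gaussLaguerreRemainder n g ξ := by
  have hne : (laguerreNodes n).Nonempty := by
    rw [← Finset.card_pos, card_laguerreNodes]; omega
  obtain ⟨H, hHdeg, hH⟩ := exists_hermite_interpolant hne g (deriv g)
  rw [card_laguerreNodes] at hHdeg
  have hsum : gaussLaguerreSum n g = expIntegral H := by
    rw [← gaussLaguerreSum_eval hHdeg, gaussLaguerreSum, gaussLaguerreSum]
    exact Finset.sum_congr rfl fun x hx => by rw [(hH x hx).1]
  have hF : ((2 * n).factorial : ℝ) ≠ 0 := by positivity
  have hn0 : (n.factorial : ℝ) ≠ 0 := by positivity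
  set E := (∫ u in Set.Ioi (0 : ℝ), Real.exp (-u) * g u) - expIntegral H with hE
  -- `m` is the weighted mean of `g^{(2n)}`
  set m := E * (2 * n).factorial / (n.factorial : ℝ) ^ 2 with hm
  set D := iteratedDeriv (2 * n) g '' Set.Ioi 0 with hD
  have hcont : ContinuousOn (iteratedDeriv (2 * n) g) (Set.Ioi 0) :=
    (hg.continuousOn_iteratedDerivWithin le_rfl isOpen_Ioi.uniqueDiffOn).congr
      fun x hx => (iteratedDerivWithin_of_isOpen isOpen_Ioi hx).symm
  have hDord : D.OrdConnected := (isPreconnected_Ioi.image _ hcont).ordConnected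
  set F : ℝ → ℝ := fun u => Real.exp (-u) * g u - Real.exp (-u) * H.eval u -
    m / ((2 * n).factorial : ℝ) * (Real.exp (-u) * (laguerreNodal n ^ 2).eval u) with hFdef
  have hint' : IntegrableOn (fun u => Real.exp (-u) * g u - Real.exp (-u) * H.eval u)
      (Set.Ioi 0) := hint.sub (integrableOn_exp_neg_mul_eval H)
  have hFint : IntegrableOn F (Set.Ioi 0) :=
    hint'.sub ((integrableOn_exp_neg_mul_eval (laguerreNodal n ^ 2)).const_mul _)
  have hF0 : ∫ u in Set.Ioi (0 : ℝ), F u = 0 := by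
    simp only [hFdef]
    rw [integral_sub hint'
      ((integrableOn_exp_neg_mul_eval (laguerreNodal n ^ 2)).const_mul _),
      integral_sub hint (integrableOn_exp_neg_mul_eval H), integral_const_mul,
      ← expIntegral_apply, ← expIntegral_apply, expIntegral_laguerreNodal_sq, ← hE, hm]
    field_simp
    ring
  have hvol : volume.restrict (Set.Ioi (0 : ℝ)) ≠ 0 := by
    rw [Ne, Measure.restrict_eq_zero]; simp
  have hFval : ∀ᵐ u ∂(volume.restrict (Set.Ioi (0 : ℝ))), ∃ d ∈ D, ∃ c : ℝ, 0 < c ∧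
      F u = c * (d - m) := by
    filter_upwards [ae_restrict_mem measurableSet_Ioi,
      ae_restrict_of_ae (ae_eval_ne_zero (laguerre_ne_zero n))] with u hu hu'
    obtain ⟨ξ, hξ, h⟩ := exists_hermite_error hn hg hHdeg hH hu (mem_laguerreNodes.not.2 hu')
    refine ⟨_, ⟨ξ, hξ, rfl⟩,
      Real.exp (-u) * (laguerreNodal n).eval u ^ 2 / ((2 * n).factorial : ℝ), ?_, ?_⟩
    · have : (laguerreNodal n).eval u ≠ 0 := by
        rw [laguerreNodal_eq_C_mul, Polynomial.eval_C_mul]; positivity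
      positivity
    · simp only [hFdef, ← mul_sub, h, Polynomial.eval_pow]
      field_simp
  have hmD : m ∈ D := by
    by_contra hmD
    -- otherwise `m` lies strictly on one side of all values, and `F` has a strict sign
    have hside : (∀ d ∈ D, m < d) ∨ ∀ d ∈ D, d < m := by
      by_contra! h
      obtain ⟨⟨d, hd, hdm⟩, e, he, hme⟩ := h
      exact hmD (hDord.out hd he ⟨hdm, hme⟩)
    have hstrict : ∀ G : ℝ → ℝ, IntegrableOn G (Set.Ioi 0) → ∫ u in Set.Ioi (0 : ℝ), G u = 0 →
        (∀ᵐ u ∂(volume.restrict (Set.Ioi (0 : ℝ))), 0 < G u) → False := by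
      intro G hG hG0 hpos
      have h0 := (integral_eq_zero_iff_of_nonneg_ae (hpos.mono fun u hu => hu.le) hG).1 hG0
      have : ∀ᵐ u ∂(volume.restrict (Set.Ioi (0 : ℝ))), False := by
        filter_upwards [h0, hpos] with u h1 h2 using h2.ne' h1
      rw [Filter.eventually_false_iff_eq_bot, ae_eq_bot] at this
      exact hvol this
    rcases hside with hs | hs
    · refine hstrict F hFint hF0 (hFval.mono ?_)
      rintro u ⟨d, hd, c, hc, h⟩
      rw [h]; exact mul_pos hc (sub_pos.2 (hs d hd))
    · refine hstrict (fun u => -F u) hFint.neg (by rw [integral_neg, hF0, neg_zero])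
        (hFval.mono ?_)
      rintro u ⟨d, hd, c, hc, h⟩
      rw [h, ← mul_neg, neg_sub]; exact mul_pos hc (sub_pos.2 (hs d hd))
  obtain ⟨ξ, hξ, hξm⟩ := hmD
  refine ⟨ξ, hξ, ?_⟩
  rw [gaussLaguerreRemainder, hξm, hsum, hm, hE]
  field_simp
  ring

/-! ### Euler's integral for the hypergeometric function -/

theorem integral_pow_mul_one_sub_pow (k m : ℕ) :
    ∫ t in (0 : ℝ)..1, t ^ k * (1 - t) ^ m = beta ((k : ℝ) + 1) ((m : ℝ) + 1) := by
  rw [beta_eq_betaIntegralReal _ _ (by positivity) (by positivity), Complex.betaIntegral]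
  have h : ∀ t : ℝ, (t : ℂ) ^ ((((k : ℝ) + 1 : ℝ) : ℂ) - 1) *
      (1 - (t : ℂ)) ^ ((((m : ℝ) + 1 : ℝ) : ℂ) - 1) = ((t ^ k * (1 - t) ^ m : ℝ) : ℂ) := by
    intro t
    push_cast
    rw [add_sub_cancel_right, add_sub_cancel_right, Complex.cpow_natCast, Complex.cpow_natCast]
  simp_rw [h]
  rw [intervalIntegral.integral_ofReal, Complex.ofReal_re]

theorem beta_natCast_add_one (k m : ℕ) :
    beta ((k : ℝ) + 1) ((m : ℝ) + 1) =
      (k.factorial : ℝ) * m.factorial / ((k + m + 1).factorial : ℝ) := by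
  rw [beta, Real.Gamma_nat_eq_factorial, Real.Gamma_nat_eq_factorial,
    show (k : ℝ) + 1 + (m + 1) = ((k + m + 1 : ℕ) : ℝ) + 1 by push_cast; ring,
    Real.Gamma_nat_eq_factorial]

/-- Euler's integral `∫₀¹ t^k (1 - t)^m (1 - x t)^{-(k+1)} dt`, which is
`B(k+1, m+1) ₂F₁(k+1, k+1; k+m+2; x)`. -/
noncomputable def eulerIntegral (k m : ℕ) (x : ℝ) : ℝ :=
  ∫ t in (0 : ℝ)..1, t ^ k * (1 - t) ^ m / (1 - x * t) ^ (k + 1)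

theorem one_sub_mul_pos {x t : ℝ} (hx : x < 1) (ht : t ∈ Set.Icc (0 : ℝ) 1) : 0 < 1 - x * t := by
  obtain ⟨h0, h1⟩ := ht
  rcases le_or_gt x 0 with h | h
  · nlinarith [mul_nonneg (neg_nonneg.2 h) h0]
  · nlinarith [mul_le_mul_of_nonneg_left h1 h.le]

/-- The complexified Euler integral is holomorphic on the half-plane `re z < 1`, where the
denominator is bounded below locally uniformly in `z`. -/
theorem differentiableOn_complex_eulerIntegral (k m : ℕ) :
    DifferentiableOn ℂ (fun z : ℂ => ∫ t in (0 : ℝ)..1,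
      (t : ℂ) ^ k * (1 - (t : ℂ)) ^ m / (1 - z * t) ^ (k + 1)) {z | z.re < 1} := by
  intro z₀ hz₀
  obtain ⟨r, hr, hr1⟩ := exists_between (show z₀.re < 1 from hz₀)
  set δ : ℝ := 1 - max 0 r with hδ
  have hδ0 : 0 < δ := by
    have : max 0 r < 1 := max_lt one_pos hr1
    linarith
  have hs : {z : ℂ | z.re < r} ∈ nhds z₀ :=
    (isOpen_lt Complex.continuous_re continuous_const).mem_nhds hr
  have hlow : ∀ z : ℂ, z.re < r → ∀ t ∈ Set.Icc (0 : ℝ) 1, δ ≤ ‖1 - z * t‖ := by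
    intro z hz t ht
    refine le_trans ?_ (Complex.re_le_norm _)
    have h1 : z.re * t ≤ max 0 r := by
      rcases le_or_gt z.re 0 with h | h
      · exact (mul_nonpos_of_nonpos_of_nonneg h ht.1).trans (le_max_left _ _)
      · exact ((mul_le_of_le_one_right h.le ht.2).trans hz.le).trans (le_max_right _ _)
    simp only [Complex.sub_re, Complex.one_re, Complex.mul_re, Complex.ofReal_re,
      Complex.ofReal_im, mul_zero, sub_zero]
    linarith
  have hne : ∀ z : ℂ, z.re < r → ∀ t ∈ Set.Icc (0 : ℝ) 1, 1 - z * t ≠ 0 := fun z hz t ht h => by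
    have := hlow z hz t ht
    rw [h, norm_zero] at this
    linarith
  have hcont : ∀ z : ℂ, z.re < r → ∀ j, ContinuousOn (fun t : ℝ =>
      (t : ℂ) ^ k * (1 - (t : ℂ)) ^ m / (1 - z * t) ^ j) (Set.Icc 0 1) := fun z hz j =>
    ContinuousOn.div (by fun_prop) (by fun_prop) fun t ht => pow_ne_zero _ (hne z hz t ht)
  have hmeas : ∀ f : ℝ → ℂ, ContinuousOn f (Set.Icc 0 1) →
      AEStronglyMeasurable f (volume.restrict (Set.uIoc (0 : ℝ) 1)) := fun f hf => by
    rw [Set.uIoc_of_le zero_le_one]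
    exact (hf.mono Set.Ioc_subset_Icc_self).aestronglyMeasurable measurableSet_Ioc
  refine (intervalIntegral.hasDerivAt_integral_of_dominated_loc_of_deriv_le (𝕜 := ℂ)
    (F' := fun z t => (t : ℂ) ^ k * (1 - (t : ℂ)) ^ m / (1 - z * t) ^ (k + 2) * ((k + 1) * t))
    (bound := fun _ => (k + 1) / δ ^ (k + 2)) hs ?_ ?_ ?_ ?_ ?_
    ?_).2.differentiableAt.differentiableWithinAt
  · filter_upwards [hs] with z hz using hmeas _ (hcont z hz _)
  · refine ContinuousOn.intervalIntegrable ?_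
    rw [Set.uIcc_of_le zero_le_one]
    exact hcont z₀ hr _
  · exact hmeas _ ((hcont z₀ hr _).mul (by fun_prop))
  · refine .of_forall fun t ht z hz => ?_
    rw [Set.uIoc_of_le zero_le_one] at ht
    have ht' := Set.Ioc_subset_Icc_self ht
    have e1 : ‖(t : ℂ)‖ = t := by rw [Complex.norm_real, Real.norm_of_nonneg ht'.1]
    have e2 : ‖(1 : ℂ) - t‖ = 1 - t := by
      rw [← Complex.ofReal_one, ← Complex.ofReal_sub, Complex.norm_real,
        Real.norm_of_nonneg (by linarith [ht'.2])]
    have e3 : ‖(k : ℂ) + 1‖ = k + 1 := by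
      rw [← Nat.cast_succ, Complex.norm_natCast]; simp
    rw [norm_mul, norm_div, norm_mul, norm_mul, norm_pow, norm_pow, norm_pow, e1, e2, e3]
    have h1 : t ^ k * (1 - t) ^ m ≤ 1 :=
      mul_le_one₀ (pow_le_one₀ ht'.1 ht'.2) (pow_nonneg (by linarith [ht'.2]) _)
        (pow_le_one₀ (by linarith [ht'.2]) (by linarith [ht'.1]))
    have h2 : δ ^ (k + 2) ≤ ‖1 - z * t‖ ^ (k + 2) :=
      pow_le_pow_left₀ hδ0.le (hlow z hz t ht') _
    have h3 : (k + 1) * t ≤ (k : ℝ) + 1 := mul_le_of_le_one_right (by positivity) ht'.2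
    calc t ^ k * (1 - t) ^ m / ‖1 - z * t‖ ^ (k + 2) * ((k + 1) * t)
        ≤ 1 / δ ^ (k + 2) * (k + 1) := by
          refine mul_le_mul (div_le_div₀ zero_le_one h1 (by positivity) h2) h3
            (mul_nonneg (by positivity) ht'.1) (by positivity)
      _ = (k + 1) / δ ^ (k + 2) := by ring
  · exact intervalIntegrable_const
  · refine .of_forall fun t ht z hz => ?_
    rw [Set.uIoc_of_le zero_le_one] at ht
    have h0 := hne z hz t (Set.Ioc_subset_Icc_self ht)
    have h1 : HasDerivAt (fun z : ℂ => 1 - z * t) (-(t : ℂ)) z := by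
      simpa using ((hasDerivAt_id z).mul_const (t : ℂ)).const_sub 1
    have h2 := ((h1.pow (k + 1)).inv (pow_ne_zero _ h0)).const_mul
      ((t : ℂ) ^ k * (1 - (t : ℂ)) ^ m)
    refine h2.congr_deriv ?_
    simp only [Pi.pow_apply]
    push_cast
    generalize 1 - z * (t : ℂ) = A at h0
    rw [show (A ^ (k + 1)) ^ 2 = A ^ k * A ^ (k + 2) by ring]
    field_simp

/-- The real function is the real part of the holomorphic one along the real axis. -/
theorem analyticOnNhd_eulerIntegral (k m : ℕ) :
    AnalyticOnNhd ℝ (eulerIntegral k m) (Set.Iio 1) := by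
  intro x hx
  have hopen : IsOpen {z : ℂ | z.re < 1} := isOpen_lt Complex.continuous_re continuous_const
  have h := ((differentiableOn_complex_eulerIntegral k m).analyticAt
    (hopen.mem_nhds (show ((x : ℂ)).re < 1 from hx))).re_ofReal
  refine h.congr (.of_forall fun y => ?_)
  have e : ∀ t : ℝ, (t : ℂ) ^ k * (1 - (t : ℂ)) ^ m / (1 - (y : ℂ) * t) ^ (k + 1) =
      ((t ^ k * (1 - t) ^ m / (1 - y * t) ^ (k + 1) : ℝ) : ℂ) := fun t => by push_cast; rfl
  simp only [e]
  rw [intervalIntegral.integral_ofReal, Complex.ofReal_re, eulerIntegral]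

theorem eval_ascPochhammer_natCast_add_one (a j : ℕ) :
    (ascPochhammer ℝ j).eval ((a : ℝ) + 1) = ((a + j).factorial : ℝ) / a.factorial := by
  have h := Nat.factorial_mul_ascFactorial a j
  rw [← Nat.cast_succ, ← ascPochhammer_eval_cast, ascPochhammer_nat_eq_ascFactorial,
    eq_div_iff (by positivity)]
  rw [mul_comm]
  exact_mod_cast h

/-- Euler's integral expanded by the negative binomial series and integrated termwise. -/
theorem eulerIntegral_eq_ordinaryHypergeometric (k m : ℕ) {x : ℝ} (hx : |x| < 1) :
    eulerIntegral k m x = beta ((k : ℝ) + 1) ((m : ℝ) + 1) *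
      ordinaryHypergeometric ((k : ℝ) + 1) ((k : ℝ) + 1) (((k + m + 1 : ℕ) : ℝ) + 1) x := by
  have hsum : HasSum (fun j : ℕ => ∫ t in (0 : ℝ)..1,
      t ^ k * (1 - t) ^ m * (((j + k).choose k : ℝ) * (x * t) ^ j)) (eulerIntegral k m x) := by
    have hsummable := (hasSum_choose_mul_geometric_of_norm_lt_one (𝕜 := ℝ) k
      (r := |x|) (by simpa using hx)).summable
    refine intervalIntegral.hasSum_integral_of_dominated_convergence
      (fun j _ => ((j + k).choose k : ℝ) * |x| ^ j)
      (fun j => (by fun_prop : Continuous _).aestronglyMeasurable) (fun j => ?_)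
      (.of_forall fun t _ => hsummable) intervalIntegrable_const (.of_forall fun t ht => ?_)
    · refine .of_forall fun t ht => ?_
      rw [Set.uIoc_of_le zero_le_one] at ht
      have h1 : |t ^ k * (1 - t) ^ m| ≤ 1 := by
        have h2 : 0 ≤ 1 - t := by linarith [ht.2]
        rw [abs_of_nonneg (mul_nonneg (pow_nonneg ht.1.le _) (pow_nonneg h2 _))]
        exact mul_le_one₀ (pow_le_one₀ ht.1.le ht.2) (pow_nonneg h2 _)
          (pow_le_one₀ h2 (by linarith [ht.1]))
      have h3 : |x * t| ^ j ≤ |x| ^ j := by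
        refine pow_le_pow_left₀ (abs_nonneg _) ?_ _
        rw [abs_mul, abs_of_pos ht.1]
        exact mul_le_of_le_one_right (abs_nonneg _) ht.2
      rw [Real.norm_eq_abs, abs_mul, abs_mul ((j + k).choose k : ℝ), abs_pow (x * t),
        abs_of_nonneg (Nat.cast_nonneg _ : (0 : ℝ) ≤ ((j + k).choose k : ℝ))]
      calc _ ≤ 1 * (((j + k).choose k : ℝ) * |x| ^ j) :=
            mul_le_mul h1 (mul_le_mul_of_nonneg_left h3 (Nat.cast_nonneg _)) (by positivity)
              zero_le_one
        _ = _ := one_mul _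
    · rw [Set.uIoc_of_le zero_le_one] at ht
      have h1 : ‖x * t‖ < 1 := by
        rw [Real.norm_eq_abs, abs_mul, abs_of_pos ht.1]
        exact (mul_le_of_le_one_right (abs_nonneg _) ht.2).trans_lt hx
      have h2 := (hasSum_choose_mul_geometric_of_norm_lt_one k h1).mul_left
        (t ^ k * (1 - t) ^ m)
      rwa [mul_one_div] at h2
  rw [← hsum.tsum_eq, ordinaryHypergeometric_eq_tsum, ← tsum_mul_left]
  refine tsum_congr fun j => ?_
  have e1 : ∀ t : ℝ, t ^ k * (1 - t) ^ m * (((j + k).choose k : ℝ) * (x * t) ^ j) =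
      ((j + k).choose k : ℝ) * x ^ j * (t ^ (k + j) * (1 - t) ^ m) := fun t => by
    rw [mul_pow, pow_add]; ring
  simp_rw [e1]
  rw [intervalIntegral.integral_const_mul, integral_pow_mul_one_sub_pow, beta_natCast_add_one,
    beta_natCast_add_one, eval_ascPochhammer_natCast_add_one, eval_ascPochhammer_natCast_add_one,
    smul_eq_mul, show k + m + 1 + j = k + j + m + 1 by ring]
  have h3 : ((j + k).choose k : ℝ) * j.factorial * k.factorial = (k + j).factorial := by
    rw [Nat.add_comm k j]
    exact_mod_cast Nat.add_choose_mul_factorial_mul_factorial j k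
  rw [← h3]
  have f1 : (j.factorial : ℝ) ≠ 0 := by positivity
  have f2 : (k.factorial : ℝ) ≠ 0 := by positivity
  have f3 : ((k + m + 1).factorial : ℝ) ≠ 0 := by positivity
  have f4 : ((k + j + m + 1).factorial : ℝ) ≠ 0 := by positivity
  field_simp

/-- The continuation is unique by the identity theorem, so the chosen one is any given one. -/
theorem gaussHypergeometric_eq {a b c : ℝ} {F : ℝ → ℝ} (hF : IsGaussHypergeometric a b c F)
    {x : ℝ} (hx : x < 1) : gaussHypergeometric a b c x = F x := by
  have hex : ∃ F : ℝ → ℝ, IsGaussHypergeometric a b c F := ⟨F, hF⟩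
  have hG := hex.choose_spec
  rw [gaussHypergeometric, dif_pos hex]
  refine hG.1.eqOn_of_preconnected_of_eventuallyEq hF.1 isPreconnected_Iio
    (z₀ := 0) (by simp) ?_ hx
  filter_upwards [Metric.ball_mem_nhds (0 : ℝ) one_pos] with y hy
  have hy' : |y| < 1 := by simpa using hy
  rw [hG.2 y hy', hF.2 y hy']

theorem gaussHypergeometric_eq_eulerIntegral (k m : ℕ) {x : ℝ} (hx : x < 1) :
    gaussHypergeometric ((k : ℝ) + 1) ((k : ℝ) + 1) ((k : ℝ) + m + 2) x =
      eulerIntegral k m x / beta ((k : ℝ) + 1) ((m : ℝ) + 1) := by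
  have hb : beta ((k : ℝ) + 1) ((m : ℝ) + 1) ≠ 0 := (beta_pos (by positivity) (by positivity)).ne'
  refine gaussHypergeometric_eq (F := fun x => eulerIntegral k m x / _)
    ⟨(analyticOnNhd_eulerIntegral k m).mul analyticOnNhd_const, fun y hy => ?_⟩ hx
  dsimp only
  rw [eulerIntegral_eq_ordinaryHypergeometric k m hy, mul_div_cancel_left₀ _ hb]
  congr 1
  push_cast
  ring

theorem eulerIntegral_nonneg (k m : ℕ) {x : ℝ} (hx : x < 1) : 0 ≤ eulerIntegral k m x := by
  refine intervalIntegral.integral_nonneg zero_le_one fun t ht => ?_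
  have := one_sub_mul_pos hx ht
  have h1 : 0 ≤ 1 - t := by linarith [ht.2]
  have h2 := ht.1
  positivity

theorem continuousOn_eulerIntegral_kernel (k m : ℕ) {x : ℝ} (hx : x < 1) :
    ContinuousOn (fun t : ℝ => t ^ k * (1 - t) ^ m / (1 - x * t) ^ (k + 1)) (Set.Icc 0 1) :=
  ContinuousOn.div (by fun_prop) (by fun_prop) fun _ ht =>
    pow_ne_zero _ (one_sub_mul_pos hx ht).ne'

/-- Decay of Euler's integral at `-∞`, from `1 + u t ≥ t (1 + u)` and `1 + u t ≥ 1`. -/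
theorem eulerIntegral_neg_le (k m : ℕ) {u : ℝ} (hu : 0 < u) :
    eulerIntegral k m (-u) ≤ 2 * (1 + u) ^ (-(k : ℝ) - 1 / 2) := by
  have hint : IntervalIntegrable (fun t : ℝ => (1 + u) ^ (-(k : ℝ) - 1 / 2) * t ^ (-(1 / 2) : ℝ))
      volume 0 1 := (intervalIntegral.intervalIntegrable_rpow' (by norm_num)).const_mul _
  have h2 : ∫ t in (0 : ℝ)..1, (1 + u) ^ (-(k : ℝ) - 1 / 2) * t ^ (-(1 / 2) : ℝ) =
      2 * (1 + u) ^ (-(k : ℝ) - 1 / 2) := by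
    rw [intervalIntegral.integral_const_mul, integral_rpow (Or.inl (by norm_num))]
    norm_num
    ring
  rw [← h2, eulerIntegral]
  refine intervalIntegral.integral_mono_on_of_le_Ioo zero_le_one ?_ hint fun t ht => ?_
  · refine ContinuousOn.intervalIntegrable ?_
    rw [Set.uIcc_of_le zero_le_one]
    exact continuousOn_eulerIntegral_kernel k m (by linarith)
  · obtain ⟨ht0, ht1⟩ := ht
    have hb1 : t * (1 + u) ≤ 1 + u * t := by nlinarith
    have hb2 : (1 : ℝ) ≤ 1 + u * t := by nlinarith [mul_pos hu ht0]
    have hb0 : 0 < t * (1 + u) := by positivity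
    have hsq : (t * (1 + u)) ^ (1 / 2 : ℝ) ≤ 1 + u * t := by
      rw [← Real.sqrt_eq_rpow]
      refine Real.sqrt_le_iff.2 ⟨by linarith, hb1.trans ?_⟩
      nlinarith
    have e : 1 - -u * t = 1 + u * t := by ring
    rw [e]
    have h3 : t ^ k * (1 - t) ^ m ≤ t ^ k :=
      mul_le_of_le_one_right (by positivity) (pow_le_one₀ (by linarith) (by linarith))
    calc t ^ k * (1 - t) ^ m / (1 + u * t) ^ (k + 1)
        ≤ t ^ k / ((t * (1 + u)) ^ k * (t * (1 + u)) ^ (1 / 2 : ℝ)) := by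
          refine div_le_div₀ (by positivity) h3 (by positivity) ?_
          rw [pow_succ]
          exact mul_le_mul (pow_le_pow_left₀ hb0.le hb1 _) hsq (by positivity) (by positivity)
      _ = (1 + u) ^ (-(k : ℝ) - 1 / 2) * t ^ (-(1 / 2) : ℝ) := by
          rw [Real.mul_rpow ht0.le (by positivity), Real.rpow_sub (by positivity),
            Real.rpow_neg (by positivity), Real.rpow_neg ht0.le, Real.rpow_natCast, mul_pow]
          have : t ^ (1 / 2 : ℝ) ≠ 0 := by positivity
          field_simp

/-! ### Regularity and integrability of the integrand -/

theorem integrand_eq (a : ℝ) (k m i l p : ℕ) {u : ℝ} (hu : 0 < u) :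
    integrand a (m + 2) (k + 2) i l p u =
      Real.exp (-(a * (m + 2 : ℕ) * (k + 2 : ℕ) / (1 + u))) *
        (1 + u) ^ (-3 - (i : ℤ) + l + (k + 2 : ℕ) - p) *
        (eulerIntegral k m (-u) / beta ((k : ℝ) + 1) ((m : ℝ) + 1)) := by
  rw [integrand, ← gaussHypergeometric_eq_eulerIntegral k m (by linarith : -u < 1)]
  congr 2 <;> (push_cast; ring)

theorem contDiffOn_integrand (a : ℝ) (k m i l p : ℕ) (r : WithTop ℕ∞) :
    ContDiffOn ℝ r (integrand a (m + 2) (k + 2) i l p) (Set.Ioi 0) := by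
  have hE : ContDiffOn ℝ r (fun u => eulerIntegral k m (-u)) (Set.Ioi 0) :=
    (analyticOnNhd_eulerIntegral k m).contDiffOn (uniqueDiffOn_Iio 1) |>.comp
      contDiff_neg.contDiffOn fun u hu => by
        have : (0 : ℝ) < u := hu
        show -u < 1
        linarith
  have hne : ∀ u ∈ Set.Ioi (0 : ℝ), 1 + u ≠ 0 := fun u hu => by
    have : (0 : ℝ) < u := hu
    positivity
  have hlin : ContDiffOn ℝ r (fun u : ℝ => 1 + u) (Set.Ioi 0) := by fun_prop
  have hz : ContDiffOn ℝ r (fun u : ℝ => (1 + u) ^ (-3 - (i : ℤ) + l + (k + 2 : ℕ) - p))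
      (Set.Ioi 0) := fun u hu =>
    ((analyticAt_const.add analyticAt_id).zpow (hne u hu)).contDiffAt.contDiffWithinAt
  refine ContDiffOn.congr ?_ fun u hu => integrand_eq a k m i l p hu
  exact (((contDiffOn_const.div hlin hne).neg.exp).mul hz).mul (hE.div_const _)

theorem contDiffOn_weightedIntegrand (a : ℝ) (k m i l p : ℕ) (r : WithTop ℕ∞) :
    ContDiffOn ℝ r (weightedIntegrand a (m + 2) (k + 2) i l p) (Set.Ioi 0) :=
  Real.contDiff_exp.contDiffOn.mul (contDiffOn_integrand a k m i l p r)

/-- The power of `1 + u` is at most `k - 1`, and the decay `-(k + 1/2)` of Euler's integral leaves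
`(1 + u)^{-3/2}`. -/
theorem integrableOn_integrand {a : ℝ} (ha : 0 ≤ a) (k m : ℕ) {i l : ℕ} (hli : l ≤ i) (p : ℕ) :
    IntegrableOn (integrand a (m + 2) (k + 2) i l p) (Set.Ioi 0) := by
  have hb := beta_pos (show (0 : ℝ) < (k : ℝ) + 1 by positivity)
    (show (0 : ℝ) < (m : ℝ) + 1 by positivity)
  have hdom : IntegrableOn (fun u : ℝ => 2 / beta ((k : ℝ) + 1) ((m : ℝ) + 1) *
      (u + 1) ^ (-(3 / 2) : ℝ)) (Set.Ioi 0) :=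
    (integrableOn_add_rpow_Ioi_of_lt (by norm_num) (by norm_num)).const_mul _
  refine Integrable.mono' hdom
    ((contDiffOn_integrand a k m i l p 0).continuousOn.aestronglyMeasurable measurableSet_Ioi) ?_
  filter_upwards [ae_restrict_mem measurableSet_Ioi] with u hu
  have hu0 : (0 : ℝ) < u := hu
  have hE0 := eulerIntegral_nonneg k m (by linarith : -u < 1)
  rw [integrand_eq a k m i l p hu0, Real.norm_of_nonneg (by positivity)]
  have h1 : Real.exp (-(a * (m + 2 : ℕ) * (k + 2 : ℕ) / (1 + u))) ≤ 1 := by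
    rw [Real.exp_le_one_iff, neg_nonpos]; positivity
  have h2 : (1 + u) ^ (-3 - (i : ℤ) + l + (k + 2 : ℕ) - p) ≤ (1 + u) ^ ((k : ℝ) - 1) := by
    rw [← Real.rpow_intCast]
    refine Real.rpow_le_rpow_of_exponent_le (by linarith) ?_
    have : (l : ℝ) ≤ i := by exact_mod_cast hli
    have : (0 : ℝ) ≤ p := Nat.cast_nonneg _
    push_cast
    linarith
  have h3 := eulerIntegral_neg_le k m hu0
  calc _ ≤ 1 * (1 + u) ^ ((k : ℝ) - 1) *
        (2 * (1 + u) ^ (-(k : ℝ) - 1 / 2) / beta ((k : ℝ) + 1) ((m : ℝ) + 1)) := by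
        gcongr
    _ = 2 / beta ((k : ℝ) + 1) ((m : ℝ) + 1) *
        ((1 + u) ^ ((k : ℝ) - 1) * (1 + u) ^ (-(k : ℝ) - 1 / 2)) := by ring
    _ = _ := by
        rw [← Real.rpow_add (by positivity), add_comm 1 u]
        congr 2
        ring

open scoped ENNReal

/-! ### Squared norm and beamforming gain of a Gaussian vector -/

instance isGaussian_stdComplexGaussian : IsGaussian stdComplexGaussian := by
  have : stdComplexGaussian = ((gaussianReal 0 (1 / 2)).prod (gaussianReal 0 (1 / 2))).map
      Complex.equivRealProdCLM.symm := rfl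
  rw [this]
  infer_instance

theorem measurable_complex_mk : Measurable fun p : ℝ × ℝ => (⟨p.1, p.2⟩ : ℂ) :=
  Complex.measurableEquivRealProd.symm.measurable

theorem integral_stdComplexGaussian : ∫ z, z ∂stdComplexGaussian = 0 := by
  have hint : Integrable (fun z : ℂ => z) stdComplexGaussian := IsGaussian.integrable_id
  have hre : ∫ z : ℂ, z.re ∂stdComplexGaussian = 0 := by
    rw [stdComplexGaussian, integral_map measurable_complex_mk.aemeasurable
      Complex.measurable_re.aestronglyMeasurable]
    have := integral_fun_fst (μ := gaussianReal 0 (1 / 2)) (ν := gaussianReal 0 (1 / 2))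
      (fun x : ℝ => x)
    rw [this]
    simp
  have him : ∫ z : ℂ, z.im ∂stdComplexGaussian = 0 := by
    rw [stdComplexGaussian, integral_map measurable_complex_mk.aemeasurable
      Complex.measurable_im.aestronglyMeasurable]
    have := integral_fun_snd (μ := gaussianReal 0 (1 / 2)) (ν := gaussianReal 0 (1 / 2))
      (fun x : ℝ => x)
    rw [this]
    simp
  apply Complex.ext
  · have := integral_re hint
    simpa [hre] using this.symm
  · have := integral_im hint
    simpa [him] using this.symm

/-- Invariance of a pair of independent `𝒞𝒩(0, 1)` variables under rotations of the pair. -/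
theorem lintegral_stdComplexGaussian_rotate {c s : ℝ} (hcs : c ^ 2 + s ^ 2 = 1)
    {G : ℂ → ℂ → ℝ≥0∞} (hG : Measurable (Function.uncurry G)) :
    ∫⁻ z, ∫⁻ w, G (c * z + s * w) (-s * z + c * w) ∂stdComplexGaussian ∂stdComplexGaussian =
      ∫⁻ z, ∫⁻ w, G z w ∂stdComplexGaussian ∂stdComplexGaussian := by
  obtain ⟨θ, hθc, hθs⟩ : ∃ θ, Real.cos θ = c ∧ Real.sin θ = s := by
    have hn : ‖(⟨c, s⟩ : ℂ)‖ = 1 := by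
      rw [← pow_left_inj₀ (norm_nonneg _) zero_le_one two_ne_zero, ← Complex.normSq_eq_norm_sq,
        Complex.normSq_mk]
      linarith
    have hne : (⟨c, s⟩ : ℂ) ≠ 0 := by
      intro h
      rw [h, norm_zero] at hn
      exact zero_ne_one hn
    refine ⟨Complex.arg ⟨c, s⟩, ?_, ?_⟩
    · rw [Complex.cos_arg hne, hn, div_one]
    · rw [Complex.sin_arg, hn, div_one]
  have h := IsGaussian.map_rotation_eq_self (μ := stdComplexGaussian)
    (by simpa using integral_stdComplexGaussian) θ
  rw [lintegral_lintegral hG.aemeasurable]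
  conv_rhs => rw [← h]
  rw [lintegral_map (by exact hG) (ContinuousLinearMap.continuous _).measurable,
    lintegral_lintegral]
  · refine lintegral_congr fun p => ?_
    simp [ContinuousLinearMap.rotation_apply, hθc, hθs]
  · refine Measurable.aemeasurable ?_
    have : Measurable fun p : ℂ × ℂ => ((c * p.1 + s * p.2, -s * p.1 + c * p.2) : ℂ × ℂ) := by
      fun_prop
    exact hG.comp this

theorem lintegral_image_of_hasDerivAt {s t : Set ℝ} {f f' : ℝ → ℝ} (hs : MeasurableSet s)
    (hf : ∀ x ∈ s, HasDerivAt f (f' x) x) (hf' : ∀ x ∈ s, 0 ≤ f' x) (hinj : Set.InjOn f s)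
    (ht : f '' s = t) (g : ℝ → ℝ≥0∞) :
    ∫⁻ x in t, g x = ∫⁻ x in s, ENNReal.ofReal (f' x) * g (f x) := by
  rw [← ht, lintegral_image_eq_lintegral_abs_deriv_mul hs
    (fun x hx => (hf x hx).hasDerivWithinAt) hinj]
  exact setLIntegral_congr_fun hs fun x hx => by simp only [abs_of_nonneg (hf' x hx)]

/-- `|z|²` is exponentially distributed with mean one for `z ∼ 𝒞𝒩(0, 1)`. -/
theorem lintegral_norm_sq_stdComplexGaussian {φ : ℝ → ℝ≥0∞} (hφ : Measurable φ) :
    ∫⁻ z, φ (‖z‖ ^ 2) ∂stdComplexGaussian =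
      ∫⁻ s in Set.Ioi (0 : ℝ), ENNReal.ofReal (Real.exp (-s)) * φ s := by
  have hv : (1 / 2 : NNReal) ≠ 0 := by norm_num
  rw [stdComplexGaussian, lintegral_map (by fun_prop) measurable_complex_mk,
    gaussianReal_of_var_ne_zero _ hv, prod_withDensity (measurable_gaussianPDF _ _)
      (measurable_gaussianPDF _ _), lintegral_withDensity_eq_lintegral_mul _ (by fun_prop)
      (by
        have : Measurable fun p : ℝ × ℝ => ‖(⟨p.1, p.2⟩ : ℂ)‖ :=
          measurable_norm.comp measurable_complex_mk
        fun_prop)]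
  rw [← Measure.volume_eq_prod, ← lintegral_comp_polarCoord_symm, polarCoord_target,
    Measure.volume_eq_prod, ← Measure.prod_restrict]
  have e : ∀ p : ℝ × ℝ, ENNReal.ofReal p.1 • ((fun z : ℝ × ℝ =>
      gaussianPDF 0 (1 / 2) z.1 * gaussianPDF 0 (1 / 2) z.2) *
        fun p : ℝ × ℝ => φ (‖(⟨p.1, p.2⟩ : ℂ)‖ ^ 2)) (polarCoord.symm p) =
      ENNReal.ofReal p.1 * (ENNReal.ofReal (Real.pi⁻¹ * Real.exp (-p.1 ^ 2)) * φ (p.1 ^ 2)) := by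
    rintro ⟨r, θ⟩
    have hsq : (r * Real.cos θ) ^ 2 + (r * Real.sin θ) ^ 2 = r ^ 2 := by
      have := Real.cos_sq_add_sin_sq θ
      linear_combination r ^ 2 * this
    have h1 : ‖(⟨r * Real.cos θ, r * Real.sin θ⟩ : ℂ)‖ ^ 2 = r ^ 2 := by
      rw [← Complex.normSq_eq_norm_sq, Complex.normSq_mk, ← hsq]; ring
    have h2 : gaussianPDF 0 (1 / 2) (r * Real.cos θ) * gaussianPDF 0 (1 / 2) (r * Real.sin θ) =
        ENNReal.ofReal (Real.pi⁻¹ * Real.exp (-r ^ 2)) := by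
      rw [gaussianPDF, gaussianPDF, ← ENNReal.ofReal_mul (gaussianPDFReal_nonneg _ _ _),
        gaussianPDFReal, gaussianPDFReal]
      congr 1
      have h3 : (2 : ℝ) * Real.pi * ((1 / 2 : NNReal) : ℝ) = Real.pi := by
        push_cast; ring
      have h4 : (Real.sqrt Real.pi)⁻¹ * (Real.sqrt Real.pi)⁻¹ = Real.pi⁻¹ := by
        rw [← mul_inv, Real.mul_self_sqrt Real.pi_pos.le]
      rw [h3, mul_mul_mul_comm, h4, ← Real.exp_add]
      congr 2
      rw [← hsq]
      push_cast
      ring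
    simp only [polarCoord_symm_apply, Pi.mul_apply, smul_eq_mul, h1, h2]
  simp_rw [e]
  rw [lintegral_prod _ (by fun_prop)]
  simp only [lintegral_const, Measure.restrict_apply MeasurableSet.univ, Set.univ_inter,
    Real.volume_Ioo]
  have himg : (fun r : ℝ => r ^ 2) '' Set.Ioi 0 = Set.Ioi 0 := by
    ext x
    simp only [Set.mem_image, Set.mem_Ioi]
    constructor
    · rintro ⟨r, hr, rfl⟩; positivity
    · exact fun hx => ⟨Real.sqrt x, Real.sqrt_pos.2 hx, Real.sq_sqrt hx.le⟩
  have hsubst := lintegral_image_of_hasDerivAt (f' := fun r => 2 * r) measurableSet_Ioi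
    (fun r _ => by simpa using hasDerivAt_pow 2 r)
    (fun r hr => by have : (0 : ℝ) < r := hr; positivity)
    (fun a ha b hb hab => by
      have ha' : (0 : ℝ) < a := ha
      have hb' : (0 : ℝ) < b := hb
      exact (pow_left_inj₀ ha'.le hb'.le two_ne_zero).1 hab) himg
    (fun s => ENNReal.ofReal (Real.exp (-s)) * φ s)
  rw [hsubst]
  refine setLIntegral_congr_fun measurableSet_Ioi fun r hr => ?_
  have hr' : (0 : ℝ) < r := hr
  have hc : ENNReal.ofReal r * ENNReal.ofReal (Real.pi⁻¹ * Real.exp (-r ^ 2)) *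
      ENNReal.ofReal (Real.pi - -Real.pi) =
        ENNReal.ofReal (2 * r) * ENNReal.ofReal (Real.exp (-r ^ 2)) := by
    rw [← ENNReal.ofReal_mul hr'.le, ← ENNReal.ofReal_mul (by positivity),
      ← ENNReal.ofReal_mul (by positivity)]
    congr 1
    have := Real.pi_pos.ne'
    field_simp
    ring
  rw [← mul_assoc, ← mul_assoc, ← hc]
  ring

/-- The joint law of `k` independent `𝒞𝒩(0, 1)` entries. -/
noncomputable abbrev gaussianVector (k : ℕ) : Measure (Fin k → ℂ) :=
  Measure.pi fun _ => stdComplexGaussian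

theorem lintegral_gaussianVector_succ {k : ℕ} {F : (Fin (k + 1) → ℂ) → ℝ≥0∞} (hF : Measurable F) :
    ∫⁻ h, F h ∂gaussianVector (k + 1) =
      ∫⁻ z, ∫⁻ h, F (Fin.cons z h) ∂gaussianVector k ∂stdComplexGaussian := by
  have hmp := (measurePreserving_piFinSuccAbove
    (fun _ : Fin (k + 1) => stdComplexGaussian) 0).symm
  have hcons : ∀ z h, (MeasurableEquiv.piFinSuccAbove (fun _ : Fin (k + 1) => ℂ) 0).symm (z, h) =
      Fin.cons z h := fun z h => Fin.insertNth_zero' z h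
  rw [← hmp.lintegral_comp hF, lintegral_prod _ (by fun_prop)]
  simp only [hcons]

theorem normSq_cons {k : ℕ} (z : ℂ) (h : Fin k → ℂ) :
    normSq (Fin.cons z h : Fin (k + 1) → ℂ) = ‖z‖ ^ 2 + normSq h := by
  simp [normSq, Fin.sum_univ_succ]

theorem normSq_nonneg {k : ℕ} (h : Fin k → ℂ) : 0 ≤ normSq h :=
  Finset.sum_nonneg fun _ _ => by positivity

@[fun_prop]
theorem measurable_normSq {k : ℕ} : Measurable (normSq : (Fin k → ℂ) → ℝ) := by
  unfold normSq
  fun_prop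

/-- The normalised sum of the entries of a Gaussian vector is again `𝒞𝒩(0, 1)`, and the squared
norm of the orthogonal component is independent of it and distributed like the squared norm of a
vector with one entry fewer. Each inductive step is one rotation in two coordinates. -/
theorem lintegral_sum_normSq_gaussianVector (k : ℕ) {φ : ℂ → ℝ → ℝ≥0∞}
    (hφ : Measurable (Function.uncurry φ)) :
    ∫⁻ h, φ ((∑ i, h i) / (Real.sqrt (k + 1) : ℂ)) (normSq h - ‖∑ i, h i‖ ^ 2 / (k + 1))
        ∂gaussianVector (k + 1) =
      ∫⁻ z, ∫⁻ h, φ z (normSq h) ∂gaussianVector k ∂stdComplexGaussian := by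
  induction k generalizing φ with
  | zero =>
    rw [lintegral_gaussianVector_succ]
    · simp [normSq]
    · exact hφ.comp (by fun_prop : Measurable fun h : Fin (0 + 1) → ℂ =>
        ((∑ i, h i) / (Real.sqrt ((0 : ℕ) + 1) : ℂ),
          normSq h - ‖∑ i, h i‖ ^ 2 / (((0 : ℕ) : ℝ) + 1)))
  | succ k ih =>
    set a : ℝ := Real.sqrt (k + 1) with ha
    set b : ℝ := Real.sqrt ((k + 1 : ℕ) + 1) with hb
    have ha2 : a ^ 2 = k + 1 := Real.sq_sqrt (by positivity)
    have hb2 : b ^ 2 = k + 2 := by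
      rw [hb, Real.sq_sqrt (by positivity)]; push_cast; ring
    have ha0 : 0 < a := Real.sqrt_pos.2 (by positivity)
    have hb0 : 0 < b := Real.sqrt_pos.2 (by positivity)
    have haC : (a : ℂ) ≠ 0 := by exact_mod_cast ha0.ne'
    have hbC : (b : ℂ) ≠ 0 := by exact_mod_cast hb0.ne'
    rw [lintegral_gaussianVector_succ]
    swap
    · exact hφ.comp (by fun_prop : Measurable fun h : Fin (k + 1 + 1) → ℂ =>
        ((∑ i, h i) / (b : ℂ), normSq h - ‖∑ i, h i‖ ^ 2 / (((k + 1 : ℕ) : ℝ) + 1)))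
    -- the contribution of the first entry `z` and of the normalised sum `w` of the others
    set ψ : ℂ → ℂ → ℝ → ℝ≥0∞ := fun z w r =>
      φ ((z + a * w) / b) (‖z‖ ^ 2 + (r + ‖w‖ ^ 2) - ‖z + a * w‖ ^ 2 / b ^ 2) with hψ
    have hstep : ∀ z : ℂ,
        ∫⁻ h, φ ((∑ i, (Fin.cons z h : Fin (k + 1 + 1) → ℂ) i) / (b : ℂ))
          (normSq (Fin.cons z h : Fin (k + 1 + 1) → ℂ) -
            ‖∑ i, (Fin.cons z h : Fin (k + 1 + 1) → ℂ) i‖ ^ 2 / (((k + 1 : ℕ) : ℝ) + 1))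
          ∂gaussianVector (k + 1) =
        ∫⁻ w, ∫⁻ h, ψ z w (normSq h) ∂gaussianVector k ∂stdComplexGaussian := by
      intro z
      rw [← ih (φ := ψ z)]
      · refine lintegral_congr fun h => ?_
        have h1 : (a : ℂ) * ((∑ i, h i) / (a : ℂ)) = ∑ i, h i := by field_simp
        have h2 : ‖(∑ i, h i) / (a : ℂ)‖ ^ 2 = ‖∑ i, h i‖ ^ 2 / (k + 1) := by
          rw [norm_div, div_pow, Complex.norm_real, Real.norm_of_nonneg ha0.le, ha2]
        rw [hψ]
        simp only [normSq_cons, Fin.sum_univ_succ (n := k + 1), Fin.cons_zero, Fin.cons_succ]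
        rw [h1, h2, hb2]
        congr 1
        push_cast
        ring
      · exact hφ.comp (by fun_prop : Measurable fun p : ℂ × ℝ =>
          ((z + a * p.1) / (b : ℂ), ‖z‖ ^ 2 + (p.2 + ‖p.1‖ ^ 2) - ‖z + a * p.1‖ ^ 2 / b ^ 2))
    simp_rw [hstep]
    set G : ℂ → ℂ → ℝ≥0∞ := fun z w => ∫⁻ h, φ z (‖w‖ ^ 2 + normSq h) ∂gaussianVector k with hG
    have hGm : Measurable (Function.uncurry G) := by
      have : Measurable fun p : (ℂ × ℂ) × (Fin k → ℂ) =>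
          φ p.1.1 (‖p.1.2‖ ^ 2 + normSq p.2) :=
        hφ.comp (by fun_prop : Measurable fun p : (ℂ × ℂ) × (Fin k → ℂ) =>
          (p.1.1, ‖p.1.2‖ ^ 2 + normSq p.2))
      exact this.lintegral_prod_right'
    have hcs : (1 / b) ^ 2 + (a / b) ^ 2 = 1 := by
      rw [div_pow, div_pow, ha2, hb2]
      field_simp
      ring
    have hrot : ∀ z w : ℂ, ∫⁻ h, ψ z w (normSq h) ∂gaussianVector k =
        G ((1 / b : ℝ) * z + (a / b : ℝ) * w) (-(a / b : ℝ) * z + (1 / b : ℝ) * w) := by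
      intro z w
      refine lintegral_congr fun h => ?_
      have h1 : ((1 / b : ℝ) : ℂ) * z + (a / b : ℝ) * w = (z + a * w) / b := by
        push_cast; field_simp
      have h2 : -((a / b : ℝ) : ℂ) * z + (1 / b : ℝ) * w = (w - a * z) / b := by
        push_cast; field_simp; ring
      rw [h1, h2]
      refine congrArg (φ _) ?_
      rw [norm_div, div_pow, Complex.norm_real, Real.norm_of_nonneg hb0.le]
      have hkey : ‖z + a * w‖ ^ 2 + ‖w - a * z‖ ^ 2 = b ^ 2 * (‖z‖ ^ 2 + ‖w‖ ^ 2) := by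
        have hab : b ^ 2 = 1 + a ^ 2 := by rw [ha2, hb2]; ring
        rw [hab]
        simp only [← Complex.normSq_eq_norm_sq, Complex.normSq_apply, Complex.add_re,
          Complex.add_im, Complex.sub_re, Complex.sub_im, Complex.mul_re, Complex.mul_im,
          Complex.ofReal_re, Complex.ofReal_im]
        ring
      have hb2' : b ^ 2 ≠ 0 := by positivity
      generalize ‖z + a * w‖ = A at hkey ⊢
      generalize ‖w - a * z‖ = B at hkey ⊢
      field_simp
      linear_combination -hkey
    simp_rw [hrot]
    rw [lintegral_stdComplexGaussian_rotate hcs hGm]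
    refine lintegral_congr fun z => ?_
    rw [lintegral_gaussianVector_succ]
    · simp_rw [normSq_cons]
      rfl
    · exact hφ.comp (by fun_prop : Measurable fun h : Fin (k + 1) → ℂ => (z, normSq h))

/-- Tonelli's theorem on a planar region described by both of its families of sections. -/
theorem setLIntegral_swap {A B : Set ℝ} {C D : ℝ → Set ℝ} (hA : MeasurableSet A)
    (hB : MeasurableSet B) (hC : ∀ x, MeasurableSet (C x)) (hD : ∀ y, MeasurableSet (D y))
    (hR : MeasurableSet {p : ℝ × ℝ | p.1 ∈ A ∧ p.2 ∈ C p.1})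
    (hiff : ∀ x y, (x ∈ A ∧ y ∈ C x) ↔ (y ∈ B ∧ x ∈ D y)) {F : ℝ → ℝ → ℝ≥0∞}
    (hF : Measurable (Function.uncurry F)) :
    ∫⁻ x in A, ∫⁻ y in C x, F x y = ∫⁻ y in B, ∫⁻ x in D y, F x y := by
  set R := {p : ℝ × ℝ | p.1 ∈ A ∧ p.2 ∈ C p.1} with hRdef
  have h1 : ∫⁻ x in A, ∫⁻ y in C x, F x y =
      ∫⁻ x, ∫⁻ y, R.indicator (Function.uncurry F) (x, y) := by
    rw [← lintegral_indicator hA]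
    refine lintegral_congr fun x => ?_
    by_cases hx : x ∈ A
    · rw [Set.indicator_of_mem hx, ← lintegral_indicator (hC x)]
      refine lintegral_congr fun y => ?_
      by_cases hy : y ∈ C x
      · rw [Set.indicator_of_mem hy, Set.indicator_of_mem (show (x, y) ∈ R from ⟨hx, hy⟩)]
        rfl
      · rw [Set.indicator_of_notMem hy,
          Set.indicator_of_notMem (fun h : (x, y) ∈ R => hy h.2)]
    · rw [Set.indicator_of_notMem hx]
      simp_rw [fun y => Set.indicator_of_notMem (fun h : (x, y) ∈ R => hx h.1)
        (Function.uncurry F)]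
      simp
  have h2 : ∫⁻ y in B, ∫⁻ x in D y, F x y =
      ∫⁻ y, ∫⁻ x, R.indicator (Function.uncurry F) (x, y) := by
    rw [← lintegral_indicator hB]
    refine lintegral_congr fun y => ?_
    by_cases hy : y ∈ B
    · rw [Set.indicator_of_mem hy, ← lintegral_indicator (hD y)]
      refine lintegral_congr fun x => ?_
      by_cases hx : x ∈ D y
      · rw [Set.indicator_of_mem hx,
          Set.indicator_of_mem (show (x, y) ∈ R from (hiff x y).2 ⟨hy, hx⟩)]
        rfl
      · rw [Set.indicator_of_notMem hx,
          Set.indicator_of_notMem (fun h : (x, y) ∈ R => hx ((hiff x y).1 h).2)]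
    · rw [Set.indicator_of_notMem hy]
      simp_rw [fun x => Set.indicator_of_notMem
        (fun h : (x, y) ∈ R => hy ((hiff x y).1 h).1) (Function.uncurry F)]
      simp
  rw [h1, h2]
  exact lintegral_lintegral_swap (f := fun x y => R.indicator (Function.uncurry F) (x, y))
    (hF.indicator hR).aemeasurable

theorem setLIntegral_Ioo_scale {g : ℝ} (hg : 0 < g) (H : ℝ → ℝ≥0∞) :
    ∫⁻ e in Set.Ioo 0 g, H e = ∫⁻ y in Set.Ioo (0 : ℝ) 1, ENNReal.ofReal g * H (g * y) := by
  refine lintegral_image_of_hasDerivAt measurableSet_Ioo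
    (fun y _ => by simpa using (hasDerivAt_id y).const_mul g) (fun _ _ => hg.le)
    (fun a _ b _ h => mul_left_cancel₀ hg.ne' h) ?_ H
  rw [Set.image_mul_left_Ioo hg]
  simp

theorem setLIntegral_Ioi_shift (e : ℝ) (H : ℝ → ℝ≥0∞) :
    ∫⁻ g in Set.Ioi e, H g = ∫⁻ s in Set.Ioi (0 : ℝ), H (e + s) := by
  have := lintegral_image_of_hasDerivAt (s := Set.Ioi 0) (t := Set.Ioi e) (f := fun s => e + s)
    (f' := fun _ => 1) measurableSet_Ioi
    (fun y _ => by simpa using (hasDerivAt_id y).const_add e) (fun _ _ => zero_le_one)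
    (fun a _ b _ h => add_left_cancel h) (by simp) H
  simpa using this

/-- Change of variables from `(e, s)` to the sum `g = e + s` and the proportion `y = e / g`. -/
theorem lintegral_sum_proportion {F : ℝ → ℝ → ℝ≥0∞} (hF : Measurable (Function.uncurry F)) :
    ∫⁻ e in Set.Ioi (0 : ℝ), ∫⁻ s in Set.Ioi (0 : ℝ), F e (e + s) =
      ∫⁻ g in Set.Ioi (0 : ℝ), ∫⁻ y in Set.Ioo (0 : ℝ) 1, ENNReal.ofReal g * F (g * y) g := by
  simp_rw [← fun e => setLIntegral_Ioi_shift e (F e)]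
  rw [setLIntegral_swap (B := Set.Ioi 0) (D := fun g => Set.Ioo 0 g) measurableSet_Ioi
    measurableSet_Ioi (fun _ => measurableSet_Ioi) (fun _ => measurableSet_Ioo) ?_ ?_ hF]
  · exact setLIntegral_congr_fun measurableSet_Ioi fun g hg =>
      setLIntegral_Ioo_scale hg fun e => F e g
  · exact (measurableSet_lt measurable_const measurable_fst).inter
      (measurableSet_lt measurable_fst measurable_snd)
  · intro e g
    simp only [Set.mem_Ioi, Set.mem_Ioo]
    exact ⟨fun h => ⟨h.1.trans h.2, h.1, h.2⟩, fun h => ⟨h.2.1, h.2.2⟩⟩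

theorem lintegral_one_sub_pow (k : ℕ) :
    ∫⁻ y in Set.Ioo (0 : ℝ) 1, ENNReal.ofReal ((1 - y) ^ k) = ENNReal.ofReal (1 / (k + 1)) := by
  have hint : IntegrableOn (fun y : ℝ => (1 - y) ^ k) (Set.Ioo 0 1) :=
    ((by fun_prop : Continuous fun y : ℝ => (1 - y) ^ k).integrableOn_Icc).mono_set
      Set.Ioo_subset_Icc_self
  rw [← ofReal_integral_eq_lintegral_ofReal hint, ← integral_Ioc_eq_integral_Ioo,
    ← intervalIntegral.integral_of_le zero_le_one,
    intervalIntegral.integral_comp_sub_left (fun y => y ^ k) 1]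
  · simp
  · filter_upwards [ae_restrict_mem measurableSet_Ioo] with y hy
    exact pow_nonneg (by linarith [hy.2]) _

/-- The law of `|z|² + ‖h‖²` together with `|z|²`, given that `‖h‖²` has the Gamma law. -/
theorem lintegral_norm_sq_add_of_gamma {k : ℕ}
    (hγ : ∀ φ : ℝ → ℝ≥0∞, Measurable φ → ∫⁻ h, φ (normSq h) ∂gaussianVector (k + 1) =
      ∫⁻ s in Set.Ioi (0 : ℝ), ENNReal.ofReal (Real.exp (-s) * s ^ k / k.factorial) * φ s)
    {φ : ℝ → ℝ → ℝ≥0∞} (hφ : Measurable (Function.uncurry φ)) :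
    ∫⁻ z, ∫⁻ h, φ (‖z‖ ^ 2 + normSq h) (‖z‖ ^ 2) ∂gaussianVector (k + 1) ∂stdComplexGaussian =
      ∫⁻ g in Set.Ioi (0 : ℝ), ∫⁻ y in Set.Ioo (0 : ℝ) 1,
        ENNReal.ofReal (Real.exp (-g) * g ^ (k + 1) * (1 - y) ^ k / k.factorial) *
          φ g (g * y) := by
  have h1 : ∀ e : ℝ, ∫⁻ h, φ (e + normSq h) e ∂gaussianVector (k + 1) =
      ∫⁻ s in Set.Ioi (0 : ℝ), ENNReal.ofReal (Real.exp (-s) * s ^ k / k.factorial) *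
        φ (e + s) e := fun e =>
    hγ (fun s => φ (e + s) e)
      (hφ.comp (by fun_prop : Measurable fun s : ℝ => (e + s, e)))
  have hm : Measurable fun p : ℝ × ℝ =>
      ENNReal.ofReal (Real.exp (-p.2) * p.2 ^ k / k.factorial) * φ (p.1 + p.2) p.1 :=
    Measurable.mul (by fun_prop)
      (hφ.comp (by fun_prop : Measurable fun p : ℝ × ℝ => (p.1 + p.2, p.1)))
  simp_rw [h1]
  rw [lintegral_norm_sq_stdComplexGaussian (φ := fun e => ∫⁻ s in Set.Ioi (0 : ℝ),
    ENNReal.ofReal (Real.exp (-s) * s ^ k / k.factorial) * φ (e + s) e)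
    hm.lintegral_prod_right']
  set F : ℝ → ℝ → ℝ≥0∞ := fun e g => ENNReal.ofReal (Real.exp (-e)) *
    (ENNReal.ofReal (Real.exp (-(g - e)) * (g - e) ^ k / k.factorial) * φ g e) with hF
  have hFm : Measurable (Function.uncurry F) :=
    Measurable.mul (by fun_prop) (Measurable.mul (by fun_prop)
      (hφ.comp (by fun_prop : Measurable fun p : ℝ × ℝ => (p.2, p.1))))
  have h2 : ∀ e : ℝ, ENNReal.ofReal (Real.exp (-e)) * ∫⁻ s in Set.Ioi (0 : ℝ),
      ENNReal.ofReal (Real.exp (-s) * s ^ k / k.factorial) * φ (e + s) e =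
        ∫⁻ s in Set.Ioi (0 : ℝ), F e (e + s) := by
    intro e
    have hme : Measurable fun s : ℝ =>
        ENNReal.ofReal (Real.exp (-s) * s ^ k / k.factorial) * φ (e + s) e :=
      hm.comp (by fun_prop : Measurable fun s : ℝ => (e, s))
    rw [← lintegral_const_mul _ hme]
    simp only [hF, add_sub_cancel_left]
  simp_rw [h2]
  rw [lintegral_sum_proportion hFm]
  refine setLIntegral_congr_fun measurableSet_Ioi fun g hg => ?_
  refine setLIntegral_congr_fun measurableSet_Ioo fun y hy => ?_
  have hg0 : (0 : ℝ) < g := hg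
  have hy1 : 0 ≤ 1 - y := by linarith [hy.2]
  simp only [hF]
  rw [← mul_assoc, ← mul_assoc, ← ENNReal.ofReal_mul hg0.le, ← ENNReal.ofReal_mul (by positivity)]
  congr 2
  have e1 : Real.exp (-g) = Real.exp (-(g * y)) * Real.exp (-(g - g * y)) := by
    rw [← Real.exp_add]; congr 1; ring
  rw [e1, show g - g * y = g * (1 - y) by ring, mul_pow]
  ring

/-- The squared norm of a Gaussian vector with `k + 1` entries has the Gamma law of shape
`k + 1`. -/
theorem lintegral_normSq_gaussianVector (k : ℕ) {φ : ℝ → ℝ≥0∞} (hφ : Measurable φ) :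
    ∫⁻ h, φ (normSq h) ∂gaussianVector (k + 1) =
      ∫⁻ s in Set.Ioi (0 : ℝ), ENNReal.ofReal (Real.exp (-s) * s ^ k / k.factorial) * φ s := by
  induction k generalizing φ with
  | zero =>
    rw [lintegral_gaussianVector_succ (by fun_prop)]
    have h0 : ∀ h : Fin 0 → ℂ, normSq h = 0 := fun h => by simp [normSq]
    simp_rw [normSq_cons, h0]
    simp [lintegral_norm_sq_stdComplexGaussian hφ]
  | succ k ih =>
    rw [lintegral_gaussianVector_succ (by fun_prop)]
    simp_rw [normSq_cons]
    rw [lintegral_norm_sq_add_of_gamma (fun ψ hψ => ih hψ) (φ := fun g _ => φ g)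
      (hφ.comp measurable_fst)]
    refine setLIntegral_congr_fun measurableSet_Ioi fun g hg => ?_
    have hg0 : (0 : ℝ) < g := hg
    have e1 : ∀ y : ℝ, ENNReal.ofReal (Real.exp (-g) * g ^ (k + 1) * (1 - y) ^ k / k.factorial) *
        φ g = ENNReal.ofReal (Real.exp (-g) * g ^ (k + 1) / k.factorial) * φ g *
          ENNReal.ofReal ((1 - y) ^ k) := fun y => by
      rw [mul_right_comm (ENNReal.ofReal _), ← ENNReal.ofReal_mul (by positivity)]
      congr 2
      ring
    simp_rw [e1]
    rw [lintegral_const_mul _ (by fun_prop), lintegral_one_sub_pow, mul_right_comm,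
      ← ENNReal.ofReal_mul (by positivity)]
    congr 2
    rw [Nat.factorial_succ]
    push_cast
    field_simp

theorem beamGain_eq {k : ℕ} (h : Fin k → ℂ) : beamGain h = ‖∑ i, h i‖ ^ 2 / normSq h := by
  simp only [beamGain, beam, ← Finset.sum_div, norm_div, div_pow, Complex.norm_real]
  rw [Real.norm_of_nonneg (Real.sqrt_nonneg _), Real.sq_sqrt (normSq_nonneg h)]

theorem beamGain_nonneg {k : ℕ} (h : Fin k → ℂ) : 0 ≤ beamGain h := sq_nonneg _

@[fun_prop]
theorem measurable_beamGain {k : ℕ} : Measurable (beamGain : (Fin k → ℂ) → ℝ) := by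
  have : (beamGain : (Fin k → ℂ) → ℝ) = fun h => ‖∑ i, h i‖ ^ 2 / normSq h :=
    funext beamGain_eq
  rw [this]
  fun_prop

/-- For a Gaussian vector with `k + 2` entries, `‖h‖²` has the Gamma law of shape `k + 2` and is
independent of the normalised beamforming gain, which has the Beta law `B(1, k + 1)`. -/
theorem lintegral_normSq_beamGain (k : ℕ) {φ : ℝ → ℝ → ℝ≥0∞}
    (hφ : Measurable (Function.uncurry φ)) :
    ∫⁻ h, φ (normSq h) (beamGain h / (k + 2)) ∂gaussianVector (k + 2) =
      ∫⁻ g in Set.Ioi (0 : ℝ), ∫⁻ y in Set.Ioo (0 : ℝ) 1,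
        ENNReal.ofReal (Real.exp (-g) * g ^ (k + 1) * (1 - y) ^ k / k.factorial) * φ g y := by
  have hsqrt : Real.sqrt ((k + 1 : ℕ) + 1) ^ 2 = k + 2 := by
    rw [Real.sq_sqrt (by positivity)]; push_cast; ring
  have h1 : ∀ h : Fin (k + 2) → ℂ, φ (normSq h) (beamGain h / (k + 2)) =
      (fun (z : ℂ) (r : ℝ) => φ (‖z‖ ^ 2 + r) (‖z‖ ^ 2 / (‖z‖ ^ 2 + r)))
        ((∑ i, h i) / (Real.sqrt ((k + 1 : ℕ) + 1) : ℂ))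
        (normSq h - ‖∑ i, h i‖ ^ 2 / ((k + 1 : ℕ) + 1)) := by
    intro h
    have h2 : ‖(∑ i, h i) / (Real.sqrt ((k + 1 : ℕ) + 1) : ℂ)‖ ^ 2 =
        ‖∑ i, h i‖ ^ 2 / (k + 2) := by
      rw [norm_div, div_pow, Complex.norm_real, Real.norm_of_nonneg (Real.sqrt_nonneg _), hsqrt]
    have h3 : ‖∑ i, h i‖ ^ 2 / (k + 2) + (normSq h - ‖∑ i, h i‖ ^ 2 / ((k + 1 : ℕ) + 1)) =
        normSq h := by
      push_cast; ring
    simp only [h2, h3]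
    rw [beamGain_eq, div_right_comm]
  simp_rw [h1]
  rw [lintegral_sum_normSq_gaussianVector (k + 1)
    (φ := fun (z : ℂ) (r : ℝ) => φ (‖z‖ ^ 2 + r) (‖z‖ ^ 2 / (‖z‖ ^ 2 + r)))
    (hφ.comp (by fun_prop : Measurable fun p : ℂ × ℝ =>
      (‖p.1‖ ^ 2 + p.2, ‖p.1‖ ^ 2 / (‖p.1‖ ^ 2 + p.2)))),
    lintegral_norm_sq_add_of_gamma (fun ψ hψ => lintegral_normSq_gaussianVector k hψ)
      (φ := fun g e => φ g (e / g))
      (hφ.comp (by fun_prop : Measurable fun p : ℝ × ℝ => (p.1, p.2 / p.1)))]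
  refine setLIntegral_congr_fun measurableSet_Ioi fun g hg => ?_
  have hg0 : g ≠ 0 := ne_of_gt hg
  simp only [mul_div_cancel_left₀ _ hg0]

/-! ### The survival function of the Gamma law -/

/-- `P(G ≥ t) = e^{-t} ∑_{i ≤ n} t^i / i!` for `G` of Gamma law with shape `n + 1`. -/
noncomputable def gammaTail (n : ℕ) (t : ℝ) : ℝ :=
  Real.exp (-t) * ∑ i ∈ Finset.range (n + 1), t ^ i / (i.factorial : ℝ)

theorem gammaTail_nonneg (n : ℕ) {t : ℝ} (ht : 0 ≤ t) : 0 ≤ gammaTail n t :=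
  mul_nonneg (Real.exp_pos _).le (Finset.sum_nonneg fun _ _ => by positivity)

@[fun_prop]
theorem continuous_gammaTail (n : ℕ) : Continuous (gammaTail n) := by
  unfold gammaTail
  fun_prop

theorem hasDerivAt_gammaTail (n : ℕ) (t : ℝ) :
    HasDerivAt (gammaTail n) (-(Real.exp (-t) * t ^ n / n.factorial)) t := by
  induction n with
  | zero =>
    have : gammaTail 0 = fun t => Real.exp (-t) := by ext t; simp [gammaTail]
    rw [this]
    simpa using (hasDerivAt_neg t).exp
  | succ n ih =>
    have h1 : gammaTail (n + 1) = fun t => gammaTail n t +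
        Real.exp (-t) * t ^ (n + 1) / ((n + 1).factorial : ℝ) := by
      ext t
      rw [gammaTail, Finset.sum_range_succ, gammaTail]
      ring
    have h2 : HasDerivAt (fun t : ℝ => Real.exp (-t) * t ^ (n + 1) / ((n + 1).factorial : ℝ))
        ((Real.exp (-t) * -1 * t ^ (n + 1) + Real.exp (-t) * ((n + 1 : ℕ) * t ^ n)) /
          ((n + 1).factorial : ℝ)) t := by
      refine HasDerivAt.div_const ?_ _
      exact ((hasDerivAt_neg t).exp).mul (by simpa using hasDerivAt_pow (n + 1) t)
    rw [h1]
    refine (ih.add h2).congr_deriv ?_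
    rw [Nat.factorial_succ]
    push_cast
    field_simp
    ring

theorem tendsto_gammaTail (n : ℕ) : Filter.Tendsto (gammaTail n) Filter.atTop (nhds 0) := by
  have : gammaTail n = fun t => ∑ i ∈ Finset.range (n + 1),
      (t ^ i * Real.exp (-t)) * (1 / (i.factorial : ℝ)) := by
    ext t
    rw [gammaTail, Finset.mul_sum]
    exact Finset.sum_congr rfl fun i _ => by ring
  rw [this]
  have h := tendsto_finsetSum (f := fun (i : ℕ) (t : ℝ) =>
    (t ^ i * Real.exp (-t)) * (1 / (i.factorial : ℝ))) (Finset.range (n + 1)) fun i _ =>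
    (Real.tendsto_pow_mul_exp_neg_atTop_nhds_zero i).mul_const (1 / (i.factorial : ℝ))
  simpa using h

/-- The survival function is minus a primitive of the Gamma density, and vanishes at infinity. -/
theorem lintegral_gammaTail (n : ℕ) {t : ℝ} (ht : 0 ≤ t) :
    ∫⁻ g in Set.Ioi (0 : ℝ), ENNReal.ofReal (Real.exp (-g) * g ^ n / n.factorial) *
      (Set.Ici t).indicator 1 g = ENNReal.ofReal (gammaTail n t) := by
  have h1 : ∀ g : ℝ, ENNReal.ofReal (Real.exp (-g) * g ^ n / n.factorial) *
      (Set.Ici t).indicator 1 g = (Set.Ici t).indicator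
        (fun g => ENNReal.ofReal (Real.exp (-g) * g ^ n / n.factorial)) g := fun g => by
    by_cases hg : g ∈ Set.Ici t
    · simp [Set.indicator_of_mem hg]
    · simp [Set.indicator_of_notMem hg]
  have hpos : ∀ g ∈ Set.Ioi t, 0 ≤ Real.exp (-g) * g ^ n / n.factorial := fun g hg => by
    have : (0 : ℝ) ≤ g := ht.trans (le_of_lt hg)
    positivity
  have hderiv : ∀ g ∈ Set.Ici t, HasDerivAt (fun s => -gammaTail n s)
      (Real.exp (-g) * g ^ n / n.factorial) g := fun g _ => by
    exact (hasDerivAt_gammaTail n g).fun_neg.congr_deriv (neg_neg _)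
  have htend : Filter.Tendsto (fun s => -gammaTail n s) Filter.atTop (nhds 0) := by
    simpa using (tendsto_gammaTail n).neg
  have hint := integrableOn_Ioi_deriv_of_nonneg' hderiv hpos htend
  have hval := integral_Ioi_of_hasDerivAt_of_nonneg' hderiv hpos htend
  simp_rw [h1]
  rw [lintegral_indicator measurableSet_Ici, Measure.restrict_restrict measurableSet_Ici]
  have hset : (Set.Ici t ∩ Set.Ioi 0 : Set ℝ) =ᵐ[volume] Set.Ioi t := by
    have h2 : (Set.Ici t ∩ Set.Ioi 0 : Set ℝ) =ᵐ[volume] (Set.Ioi t ∩ Set.Ioi 0 : Set ℝ) :=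
      Ioi_ae_eq_Ici.symm.inter (Filter.EventuallyEq.refl _ _)
    rwa [Set.inter_eq_left.2 (Set.Ioi_subset_Ioi ht)] at h2
  rw [setLIntegral_congr hset, ← ofReal_integral_eq_lintegral_ofReal hint, hval]
  · simp
  · filter_upwards [ae_restrict_mem measurableSet_Ioi] with g hg using hpos g hg

/-! ### The product of two independent normalised gains -/

theorem lintegral_eulerIntegral (k m : ℕ) {u : ℝ} (hu : 0 < u) :
    ∫⁻ t in Set.Ioo (0 : ℝ) 1, ENNReal.ofReal (t ^ k * (1 - t) ^ m / (1 + u * t) ^ (k + 1)) =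
      ENNReal.ofReal (eulerIntegral k m (-u)) := by
  have e : ∀ t : ℝ, 1 - -u * t = 1 + u * t := fun t => by ring
  have hcont := continuousOn_eulerIntegral_kernel k m (by linarith : -u < 1)
  simp_rw [e] at hcont
  have hint : IntegrableOn (fun t : ℝ => t ^ k * (1 - t) ^ m / (1 + u * t) ^ (k + 1))
      (Set.Ioo 0 1) := hcont.integrableOn_Icc.mono_set Set.Ioo_subset_Icc_self
  rw [← ofReal_integral_eq_lintegral_ofReal hint, ← integral_Ioc_eq_integral_Ioo,
    ← intervalIntegral.integral_of_le zero_le_one, eulerIntegral]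
  · simp_rw [e]
  · filter_upwards [ae_restrict_mem measurableSet_Ioo] with t ht
    have h1 : 0 ≤ 1 - t := by linarith [ht.2]
    have h2 := ht.1
    show 0 ≤ t ^ k * (1 - t) ^ m / (1 + u * t) ^ (k + 1)
    positivity

/-- The substitution `q = 1 / (1 + u)`. -/
theorem setLIntegral_Ioo_inv_one_add (H : ℝ → ℝ≥0∞) :
    ∫⁻ q in Set.Ioo (0 : ℝ) 1, H q =
      ∫⁻ u in Set.Ioi (0 : ℝ), ENNReal.ofReal (1 / (1 + u) ^ 2) * H (1 / (1 + u)) := by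
  have himg : (fun u : ℝ => 1 / (1 + u)) '' Set.Ioi 0 = Set.Ioo 0 1 := by
    ext q
    simp only [Set.mem_image, Set.mem_Ioi, Set.mem_Ioo]
    constructor
    · rintro ⟨u, hu, rfl⟩
      exact ⟨by positivity, by rw [div_lt_one (by positivity)]; linarith⟩
    · rintro ⟨h0, h1⟩
      refine ⟨1 / q - 1, ?_, ?_⟩
      · rw [sub_pos, lt_div_iff₀ h0]; linarith
      · field_simp
        ring
  rw [← himg, lintegral_image_eq_lintegral_abs_deriv_mul (f' := fun u => -1 / (1 + u) ^ 2)
    measurableSet_Ioi]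
  · refine setLIntegral_congr_fun measurableSet_Ioi fun u hu => ?_
    have hu0 : (0 : ℝ) < u := hu
    have : |-1 / (1 + u) ^ 2| = 1 / (1 + u) ^ 2 := by
      rw [abs_div, abs_neg, abs_one, abs_of_pos (by positivity)]
    simp only [this]
  · intro u hu
    have hu0 : (0 : ℝ) < u := hu
    have h1 : HasDerivAt (fun u : ℝ => 1 + u) 1 u := (hasDerivAt_id u).const_add 1
    have h2 := h1.fun_inv (by positivity)
    simp_rw [one_div]
    exact h2.hasDerivWithinAt
  · intro u hu v hv h
    have hu0 : (0 : ℝ) < u := hu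
    have hv0 : (0 : ℝ) < v := hv
    simp only [one_div, inv_inj] at h
    linarith

/-- The substitution `x = (1 + u t) / (1 + u)`, for which `x - q` and `1 - x` become
`u t / (1 + u)` and `u (1 - t) / (1 + u)` when `q = 1 / (1 + u)`. -/
theorem setLIntegral_Ioo_inv_one_add_one {u : ℝ} (hu : 0 < u) (H : ℝ → ℝ≥0∞) :
    ∫⁻ x in Set.Ioo (1 / (1 + u)) 1, H x =
      ∫⁻ t in Set.Ioo (0 : ℝ) 1,
        ENNReal.ofReal (u / (1 + u)) * H ((1 + u * t) / (1 + u)) := by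
  have hc : 0 < u / (1 + u) := by positivity
  have hform : ∀ t : ℝ, (1 + u * t) / (1 + u) = u / (1 + u) * t + 1 / (1 + u) := fun t => by
    field_simp
    ring
  refine lintegral_image_of_hasDerivAt measurableSet_Ioo (fun t _ => ?_) (fun _ _ => hc.le)
    (fun a _ b _ h => ?_) ?_ H
  · simp_rw [hform]
    simpa using ((hasDerivAt_id t).const_mul (u / (1 + u))).add_const (1 / (1 + u))
  · simp only [hform, add_left_inj] at h
    exact mul_left_cancel₀ hc.ne' h
  · simp_rw [hform]
    rw [Set.image_affine_Ioo hc]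
    congr 1
    · ring
    · field_simp
      ring

/-- The product `q = x y` of independent variables with laws proportional to `(1 - x)^m` and
`(1 - y)^k` on `(0, 1)`, in the coordinate `u = 1 / q - 1`. -/
theorem lintegral_product_density (k m : ℕ) {ψ : ℝ → ℝ≥0∞} (hψ : Measurable ψ) :
    ∫⁻ x in Set.Ioo (0 : ℝ) 1, ∫⁻ y in Set.Ioo (0 : ℝ) 1,
        ENNReal.ofReal ((1 - x) ^ m * (1 - y) ^ k) * ψ (x * y) =
      ∫⁻ u in Set.Ioi (0 : ℝ),
        ENNReal.ofReal (u ^ (m + k + 1) / (1 + u) ^ (m + 2) * eulerIntegral k m (-u)) *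
          ψ (1 / (1 + u)) := by
  set F : ℝ → ℝ → ℝ≥0∞ := fun x q =>
    ENNReal.ofReal ((1 - x) ^ m * (x - q) ^ k / x ^ (k + 1)) * ψ q with hF
  have hFm : Measurable (Function.uncurry F) :=
    Measurable.mul (by fun_prop) (hψ.comp measurable_snd)
  have h1 : ∀ x ∈ Set.Ioo (0 : ℝ) 1, ∫⁻ y in Set.Ioo (0 : ℝ) 1,
      ENNReal.ofReal ((1 - x) ^ m * (1 - y) ^ k) * ψ (x * y) =
        ∫⁻ q in Set.Ioo 0 x, F x q := by
    intro x hx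
    have hx0 := hx.1
    have hx1 : 0 ≤ 1 - x := by linarith [hx.2]
    rw [setLIntegral_Ioo_scale hx0]
    refine setLIntegral_congr_fun measurableSet_Ioo fun y hy => ?_
    simp only [hF]
    rw [← mul_assoc, ← ENNReal.ofReal_mul hx0.le]
    congr 2
    rw [show x - x * y = x * (1 - y) by ring, mul_pow]
    field_simp
    ring
  rw [setLIntegral_congr_fun measurableSet_Ioo h1,
    setLIntegral_swap (B := Set.Ioo 0 1) (D := fun q => Set.Ioo q 1) measurableSet_Ioo
      measurableSet_Ioo (fun _ => measurableSet_Ioo) (fun _ => measurableSet_Ioo) ?_ ?_ hFm,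
    setLIntegral_Ioo_inv_one_add]
  · refine setLIntegral_congr_fun measurableSet_Ioi fun u hu => ?_
    have hu0 : (0 : ℝ) < u := hu
    set c : ℝ := u ^ (m + k + 1) / (1 + u) ^ (m + 2) with hc
    have hc0 : 0 ≤ c := by positivity
    have hFt : Measurable fun t : ℝ => F ((1 + u * t) / (1 + u)) (1 / (1 + u)) :=
      Measurable.mul_const (by fun_prop) _
    rw [setLIntegral_Ioo_inv_one_add_one hu0, ← lintegral_const_mul _ (hFt.const_mul _)]
    have h2 : ∀ t ∈ Set.Ioo (0 : ℝ) 1, ENNReal.ofReal (1 / (1 + u) ^ 2) *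
        (ENNReal.ofReal (u / (1 + u)) * F ((1 + u * t) / (1 + u)) (1 / (1 + u))) =
          ENNReal.ofReal c * ψ (1 / (1 + u)) *
            ENNReal.ofReal (t ^ k * (1 - t) ^ m / (1 + u * t) ^ (k + 1)) := by
      intro t ht
      have ht0 := ht.1
      have ht1 : 0 ≤ 1 - t := by linarith [ht.2]
      simp only [hF]
      rw [mul_right_comm (ENNReal.ofReal c), ← mul_assoc, ← mul_assoc,
        ← ENNReal.ofReal_mul (by positivity), ← ENNReal.ofReal_mul (by positivity),
        ← ENNReal.ofReal_mul hc0]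
      congr 2
      rw [show 1 - (1 + u * t) / (1 + u) = u * (1 - t) / (1 + u) by field_simp; ring,
        show (1 + u * t) / (1 + u) - 1 / (1 + u) = u * t / (1 + u) by ring, hc]
      simp only [div_pow, mul_pow]
      have h3 : 1 + u * t ≠ 0 := by positivity
      field_simp
      ring
    rw [setLIntegral_congr_fun measurableSet_Ioo h2, lintegral_const_mul _ (by fun_prop),
      lintegral_eulerIntegral k m hu0, mul_right_comm, ← ENNReal.ofReal_mul hc0]
  · exact (measurableSet_Ioo.preimage measurable_fst).inter
      ((measurableSet_lt measurable_const measurable_snd).inter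
        (measurableSet_lt measurable_snd measurable_fst))
  · intro x q
    simp only [Set.mem_Ioo]
    exact ⟨fun h => ⟨⟨h.2.1, h.2.2.trans h.1.2⟩, h.2.2, h.1.2⟩,
      fun h => ⟨⟨h.1.1.trans h.2.1, h.2.2⟩, h.1.1, h.2.1⟩⟩

/-! ### The coverage probability as an integral -/

theorem gammaTail_zero (n : ℕ) : gammaTail n 0 = 1 := by
  simp [gammaTail, Finset.sum_range_succ']

theorem measurable_uncurry_indicator_Ici {α : Type*} [MeasurableSpace α] {f g : α → ℝ}
    (hf : Measurable f) (hg : Measurable g) :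
    Measurable fun p => (Set.Ici (f p)).indicator (1 : ℝ → ℝ≥0∞) (g p) := by
  have : (fun p => (Set.Ici (f p)).indicator (1 : ℝ → ℝ≥0∞) (g p)) =
      {p | f p ≤ g p}.indicator 1 := by
    ext p
    simp [Set.indicator_apply]
  rw [this]
  exact measurable_one.indicator (measurableSet_le hf hg)

/-- The joint density splits into the Beta density and the normalised Gamma density. -/
theorem ofReal_joint_density {k : ℕ} {g y : ℝ} (hg : 0 < g) (hy : y ∈ Set.Ioo (0 : ℝ) 1) :
    ENNReal.ofReal (Real.exp (-g) * g ^ (k + 1) * (1 - y) ^ k / k.factorial) =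
      ENNReal.ofReal ((k + 1) * (1 - y) ^ k) *
        ENNReal.ofReal (Real.exp (-g) * g ^ (k + 1) / (k + 1).factorial) := by
  have h1 : 0 ≤ 1 - y := by linarith [hy.2]
  rw [← ENNReal.ofReal_mul (by positivity), Nat.factorial_succ]
  congr 1
  push_cast
  field_simp

/-- Integrating out `‖h‖²` first: coverage for one Gaussian vector, as an average over its
normalised beamforming gain. -/
theorem lintegral_gammaTail_beamGain (k : ℕ) {c b : ℝ} (hc : 0 ≤ c) (hb : 0 ≤ b) :
    ∫⁻ h, (Set.Ici (c * (beamGain h / (k + 2)) + b)).indicator 1 (normSq h)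
        ∂gaussianVector (k + 2) =
      ∫⁻ y in Set.Ioo (0 : ℝ) 1, ENNReal.ofReal ((k + 1) * (1 - y) ^ k) *
        ENNReal.ofReal (gammaTail (k + 1) (c * y + b)) := by
  have hm : Measurable (Function.uncurry fun g y : ℝ =>
      (Set.Ici (c * y + b)).indicator (1 : ℝ → ℝ≥0∞) g) :=
    measurable_uncurry_indicator_Ici (f := fun p : ℝ × ℝ => c * p.2 + b) (g := fun p => p.1)
      (by fun_prop) (by fun_prop)
  have hm' : Measurable (Function.uncurry fun g y : ℝ =>
      ENNReal.ofReal (Real.exp (-g) * g ^ (k + 1) * (1 - y) ^ k / k.factorial) *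
        (Set.Ici (c * y + b)).indicator (1 : ℝ → ℝ≥0∞) g) := Measurable.mul (by fun_prop) hm
  rw [lintegral_normSq_beamGain k (φ := fun g y => (Set.Ici (c * y + b)).indicator 1 g) hm,
    lintegral_lintegral_swap hm'.aemeasurable]
  refine setLIntegral_congr_fun measurableSet_Ioo fun y hy => ?_
  have hy0 := hy.1
  rw [← lintegral_gammaTail (k + 1) (by positivity : 0 ≤ c * y + b), ← lintegral_const_mul]
  · refine setLIntegral_congr_fun measurableSet_Ioi fun g hg => ?_
    rw [ofReal_joint_density hg hy, mul_assoc]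
  · exact Measurable.mul (by fun_prop) (measurable_one.indicator measurableSet_Ici)

/-- The normalised beamforming gain of a Gaussian vector with `m + 2` entries has the Beta law
`B(1, m + 1)`. -/
theorem lintegral_beamGain (m : ℕ) {ψ : ℝ → ℝ≥0∞} (hψ : Measurable ψ) :
    ∫⁻ h, ψ (beamGain h / (m + 2)) ∂gaussianVector (m + 2) =
      ∫⁻ y in Set.Ioo (0 : ℝ) 1, ENNReal.ofReal ((m + 1) * (1 - y) ^ m) * ψ y := by
  have hm : Measurable (Function.uncurry fun g y : ℝ =>
      ENNReal.ofReal (Real.exp (-g) * g ^ (m + 1) * (1 - y) ^ m / m.factorial) * ψ y) :=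
    Measurable.mul (by fun_prop) (hψ.comp measurable_snd)
  rw [lintegral_normSq_beamGain m (φ := fun _ y => ψ y) (hψ.comp measurable_snd),
    lintegral_lintegral_swap hm.aemeasurable]
  refine setLIntegral_congr_fun measurableSet_Ioo fun y hy => ?_
  have h1 := lintegral_gammaTail (m + 1) le_rfl
  rw [gammaTail_zero, ENNReal.ofReal_one] at h1
  have h2 : ∀ g ∈ Set.Ioi (0 : ℝ),
      ENNReal.ofReal (Real.exp (-g) * g ^ (m + 1) * (1 - y) ^ m / m.factorial) * ψ y =
        ENNReal.ofReal ((m + 1) * (1 - y) ^ m) * ψ y *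
          (ENNReal.ofReal (Real.exp (-g) * g ^ (m + 1) / (m + 1).factorial) *
            (Set.Ici 0).indicator 1 g) := fun g hg => by
    rw [ofReal_joint_density hg hy, Set.indicator_of_mem (Set.Ioi_subset_Ici_self hg),
      Pi.one_apply]
    ring
  rw [setLIntegral_congr_fun measurableSet_Ioi h2, lintegral_const_mul, h1, mul_one]
  exact Measurable.mul (by fun_prop) (measurable_one.indicator measurableSet_Ici)

/-- The probability that `‖h‖²` exceeds `a` times the product of the two beamforming gains plus
`b`, for independent Gaussian vectors. -/
theorem lintegral_coverage (k m : ℕ) {a b : ℝ} (ha : 0 ≤ a) (hb : 0 ≤ b) :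
    ∫⁻ x, ∫⁻ h, (Set.Ici (a * (beamGain h * beamGain x) + b)).indicator 1 (normSq h)
        ∂gaussianVector (k + 2) ∂gaussianVector (m + 2) =
      ∫⁻ u in Set.Ioi (0 : ℝ), ENNReal.ofReal ((m + 1) * (k + 1) *
        (u ^ (m + k + 1) / (1 + u) ^ (m + 2) * eulerIntegral k m (-u)) *
          gammaTail (k + 1) (a * (m + 2) * (k + 2) / (1 + u) + b)) := by
  set c : ℝ := a * (m + 2) * (k + 2) with hc
  have hc0 : 0 ≤ c := by positivity
  have h1 : ∀ x : Fin (m + 2) → ℂ,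
      ∫⁻ h, (Set.Ici (a * (beamGain h * beamGain x) + b)).indicator 1 (normSq h)
        ∂gaussianVector (k + 2) =
      (fun x : ℝ => ∫⁻ y in Set.Ioo (0 : ℝ) 1, ENNReal.ofReal ((k + 1) * (1 - y) ^ k) *
        ENNReal.ofReal (gammaTail (k + 1) (c * x * y + b))) (beamGain x / (m + 2)) := by
    intro x
    have hx := beamGain_nonneg x
    dsimp only
    rw [← lintegral_gammaTail_beamGain k (by positivity : 0 ≤ c * (beamGain x / (m + 2))) hb]
    refine lintegral_congr fun h => ?_
    congr 2
    rw [hc]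
    field_simp
  have hm : Measurable fun p : ℝ × ℝ => ENNReal.ofReal ((k + 1) * (1 - p.2) ^ k) *
      ENNReal.ofReal (gammaTail (k + 1) (c * p.1 * p.2 + b)) := by fun_prop
  simp_rw [h1]
  rw [lintegral_beamGain m (ψ := fun x : ℝ => ∫⁻ y in Set.Ioo (0 : ℝ) 1,
    ENNReal.ofReal ((k + 1) * (1 - y) ^ k) *
      ENNReal.ofReal (gammaTail (k + 1) (c * x * y + b))) hm.lintegral_prod_right']
  set ψ : ℝ → ℝ≥0∞ := fun q => ENNReal.ofReal ((m + 1) * (k + 1)) *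
    ENNReal.ofReal (gammaTail (k + 1) (c * q + b)) with hψ
  have hψm : Measurable ψ := by fun_prop
  have h2 : ∀ x ∈ Set.Ioo (0 : ℝ) 1, ENNReal.ofReal ((m + 1) * (1 - x) ^ m) *
      ∫⁻ y in Set.Ioo (0 : ℝ) 1, ENNReal.ofReal ((k + 1) * (1 - y) ^ k) *
        ENNReal.ofReal (gammaTail (k + 1) (c * x * y + b)) =
      ∫⁻ y in Set.Ioo (0 : ℝ) 1, ENNReal.ofReal ((1 - x) ^ m * (1 - y) ^ k) * ψ (x * y) := by
    intro x hx
    rw [← lintegral_const_mul _ (by fun_prop)]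
    refine setLIntegral_congr_fun measurableSet_Ioo fun y hy => ?_
    have hx1 : 0 ≤ 1 - x := by linarith [hx.2]
    have hy1 : 0 ≤ 1 - y := by linarith [hy.2]
    have hw : ENNReal.ofReal ((m + 1) * (1 - x) ^ m) * ENNReal.ofReal ((k + 1) * (1 - y) ^ k) =
        ENNReal.ofReal ((1 - x) ^ m * (1 - y) ^ k) * ENNReal.ofReal ((m + 1) * (k + 1)) := by
      rw [← ENNReal.ofReal_mul (by positivity), ← ENNReal.ofReal_mul (by positivity)]
      congr 1
      ring
    simp only [hψ]
    rw [mul_assoc c, ← mul_assoc (ENNReal.ofReal _), hw, mul_assoc]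
  rw [setLIntegral_congr_fun measurableSet_Ioo h2, lintegral_product_density k m hψm]
  refine setLIntegral_congr_fun measurableSet_Ioi fun u hu => ?_
  have hu0 : (0 : ℝ) < u := hu
  have hE := eulerIntegral_nonneg k m (by linarith : -u < 1)
  simp only [hψ]
  rw [← mul_assoc, ← ENNReal.ofReal_mul (by positivity), ← ENNReal.ofReal_mul (by positivity)]
  congr 1
  rw [mul_one_div]
  ring

/-! ### Expansion of the coverage integral -/

/-- The coefficient of the `(i, l, p)` quadrature in the outage formula. -/
noncomputable def outageCoeff (a b : ℝ) (M N i l p : ℕ) : ℝ :=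
  b ^ l * a ^ (i - l) * ((M : ℝ) - 1) * ((N : ℝ) - 1) / ((i.factorial : ℝ) * Real.exp b) *
    (-1) ^ p * ((M + N - 3).choose p : ℝ) * (i.choose l : ℝ) * ((M : ℝ) * N) ^ (i - l)

/-- The binomial expansion of `(u / (1 + u))^{m+k+1}` in powers of `1 / (1 + u)`, read backwards. -/
theorem sum_neg_one_pow_mul_choose_mul_zpow (k m : ℕ) {i l : ℕ} (hli : l ≤ i) {u : ℝ}
    (hu : 0 < u) :
    ∑ p ∈ Finset.range (m + k + 2), (-1) ^ p * ((m + k + 1).choose p : ℝ) *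
        (1 + u) ^ (-3 - (i : ℤ) + l + (k + 2 : ℕ) - p) =
      u ^ (m + k + 1) / (1 + u) ^ (m + 2) * (1 / (1 + u)) ^ (i - l) := by
  obtain ⟨j, rfl⟩ := Nat.exists_eq_add_of_le hli
  have hw : (1 + u) ≠ 0 := by positivity
  have h1 : (u / (1 + u)) ^ (m + k + 1) = ∑ p ∈ Finset.range (m + k + 1 + 1),
      (-1 / (1 + u)) ^ p * 1 ^ (m + k + 1 - p) * ((m + k + 1).choose p : ℝ) := by
    rw [← add_pow]
    congr 1
    field_simp
    ring
  have h2 : ∀ p : ℕ, (1 + u) ^ (-3 - ((l + j : ℕ) : ℤ) + l + (k + 2 : ℕ) - p) =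
      (1 + u) ^ (m + k + 1) / ((1 + u) ^ (m + 2) * (1 + u) ^ j) * (1 / (1 + u) ^ p) := by
    intro p
    rw [div_mul_div_comm, mul_one, ← zpow_natCast, ← zpow_natCast, ← zpow_natCast, ← zpow_natCast,
      ← zpow_add₀ hw, ← zpow_add₀ hw, ← zpow_sub₀ hw]
    congr 1
    push_cast
    ring
  have h3 : ∀ p ∈ Finset.range (m + k + 2), (-1) ^ p * ((m + k + 1).choose p : ℝ) *
      (1 + u) ^ (-3 - ((l + j : ℕ) : ℤ) + l + (k + 2 : ℕ) - p) =
        (1 + u) ^ (m + k + 1) / ((1 + u) ^ (m + 2) * (1 + u) ^ j) *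
          ((-1 / (1 + u)) ^ p * 1 ^ (m + k + 1 - p) * ((m + k + 1).choose p : ℝ)) := by
    intro p _
    rw [h2, one_pow, div_pow]
    ring
  rw [Finset.sum_congr rfl h3, ← Finset.mul_sum, ← h1, Nat.add_sub_cancel_left, div_pow, div_pow,
    one_pow]
  field_simp

/-- The coverage integrand expanded by the binomial theorem, in the powers of `a` and `b` and in
those of `u / (1 + u) = 1 - 1 / (1 + u)`. -/
theorem coverage_integrand_eq (a b : ℝ) (k m : ℕ) {u : ℝ} (hu : 0 < u) :
    (m + 1) * (k + 1) * (u ^ (m + k + 1) / (1 + u) ^ (m + 2) * eulerIntegral k m (-u)) *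
        gammaTail (k + 1) (a * (m + 2) * (k + 2) / (1 + u) + b) =
      beta ((m : ℝ) + 1) ((k : ℝ) + 1) *
        ∑ i ∈ Finset.range (k + 2), ∑ l ∈ Finset.range (i + 1), ∑ p ∈ Finset.range (m + k + 2),
          outageCoeff a b (m + 2) (k + 2) i l p * integrand a (m + 2) (k + 2) i l p u := by
  have hw : (1 + u) ≠ 0 := by positivity
  have hβ : beta ((k : ℝ) + 1) ((m : ℝ) + 1) = beta ((m : ℝ) + 1) ((k : ℝ) + 1) := by
    rw [beta_natCast_add_one, beta_natCast_add_one, mul_comm, Nat.add_comm k m]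
  have hβ0 : beta ((m : ℝ) + 1) ((k : ℝ) + 1) ≠ 0 :=
    (beta_pos (by positivity) (by positivity)).ne'
  set c : ℝ := a * (m + 2) * (k + 2) / (1 + u) with hc
  set A : ℝ := Real.exp (-c) * (eulerIntegral k m (-u) / beta ((m : ℝ) + 1) ((k : ℝ) + 1)) *
    ((m + 1) * (k + 1)) / Real.exp b with hA
  set B : ℝ := u ^ (m + k + 1) / (1 + u) ^ (m + 2) with hB
  have hinner : ∀ i, ∀ l ∈ Finset.range (i + 1), ∑ p ∈ Finset.range (m + k + 2),
      outageCoeff a b (m + 2) (k + 2) i l p * integrand a (m + 2) (k + 2) i l p u =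
        A * B / (i.factorial : ℝ) * (b ^ l * c ^ (i - l) * (i.choose l : ℝ)) := by
    intro i l hl
    have hli : l ≤ i := Nat.lt_succ_iff.1 (Finset.mem_range.1 hl)
    have hterm : ∀ p ∈ Finset.range (m + k + 2),
        outageCoeff a b (m + 2) (k + 2) i l p * integrand a (m + 2) (k + 2) i l p u =
          A / (i.factorial : ℝ) * (b ^ l * (a * ((m + 2) * (k + 2))) ^ (i - l) *
            (i.choose l : ℝ)) * ((-1) ^ p * ((m + k + 1).choose p : ℝ) *
              (1 + u) ^ (-3 - (i : ℤ) + l + (k + 2 : ℕ) - p)) := by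
      intro p _
      rw [integrand_eq a k m i l p hu, outageCoeff, show m + 2 + (k + 2) - 3 = m + k + 1 by omega,
        hβ, hA, hc, mul_pow a]
      push_cast
      ring
    rw [Finset.sum_congr rfl hterm, ← Finset.mul_sum,
      sum_neg_one_pow_mul_choose_mul_zpow k m hli hu, ← hB]
    have hcpow : c ^ (i - l) = (a * ((m + 2) * (k + 2))) ^ (i - l) * (1 / (1 + u)) ^ (i - l) := by
      rw [← mul_pow, hc]
      congr 1
      ring
    rw [hcpow]
    ring
  have hmid : ∀ i ∈ Finset.range (k + 2), ∑ l ∈ Finset.range (i + 1),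
      ∑ p ∈ Finset.range (m + k + 2),
        outageCoeff a b (m + 2) (k + 2) i l p * integrand a (m + 2) (k + 2) i l p u =
      A * B * ((c + b) ^ i / (i.factorial : ℝ)) := by
    intro i _
    rw [Finset.sum_congr rfl (hinner i), ← Finset.mul_sum, ← add_pow, add_comm b c]
    ring
  rw [Finset.sum_congr rfl hmid, ← Finset.mul_sum, gammaTail, hA, neg_add, Real.exp_add,
    Real.exp_neg b]
  field_simp

/-- The coverage integral as the finite sum of the integrals that the quadrature evaluates. -/
theorem integral_coverage {a : ℝ} (ha : 0 ≤ a) (b : ℝ) (k m : ℕ) :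
    ∫ u in Set.Ioi (0 : ℝ), (m + 1) * (k + 1) *
        (u ^ (m + k + 1) / (1 + u) ^ (m + 2) * eulerIntegral k m (-u)) *
        gammaTail (k + 1) (a * (m + 2) * (k + 2) / (1 + u) + b) =
      beta ((m : ℝ) + 1) ((k : ℝ) + 1) *
        ∑ i ∈ Finset.range (k + 2), ∑ l ∈ Finset.range (i + 1), ∑ p ∈ Finset.range (m + k + 2),
          outageCoeff a b (m + 2) (k + 2) i l p *
            ∫ u in Set.Ioi (0 : ℝ), integrand a (m + 2) (k + 2) i l p u := by
  have hint : ∀ i, ∀ l ∈ Finset.range (i + 1), ∀ p, IntegrableOn (fun u =>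
      outageCoeff a b (m + 2) (k + 2) i l p * integrand a (m + 2) (k + 2) i l p u)
        (Set.Ioi 0) := fun i l hl p =>
    (integrableOn_integrand ha k m (Nat.lt_succ_iff.1 (Finset.mem_range.1 hl)) p).const_mul _
  rw [setIntegral_congr_fun measurableSet_Ioi fun u hu => coverage_integrand_eq a b k m hu,
    integral_const_mul, integral_finsetSum _ fun i _ => integrable_finsetSum _ fun l hl =>
      integrable_finsetSum _ fun p _ => hint i l hl p]
  congr 1
  refine Finset.sum_congr rfl fun i _ => ?_
  rw [integral_finsetSum _ fun l hl => integrable_finsetSum _ fun p _ => hint i l hl p]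
  refine Finset.sum_congr rfl fun l hl => ?_
  rw [integral_finsetSum _ fun p _ => hint i l hl p]
  exact Finset.sum_congr rfl fun p _ => integral_const_mul _ _

/-! ### The outage event -/

theorem norm_sq_selfInterference (S : Params) {M N : ℕ} (htd : Fin M → ℂ) (hur : Fin N → ℂ) :
    ‖star (beam hur) ⬝ᵥ ((S.siMatrix M N)ᴴ *ᵥ beam htd)‖ ^ 2 =
      ‖S.gs‖ ^ 2 * (beamGain hur * beamGain htd) := by
  have h1 : star (beam hur) ⬝ᵥ ((S.siMatrix M N)ᴴ *ᵥ beam htd) =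
      star S.gs * (star (∑ i, beam hur i) * ∑ j, beam htd j) := by
    simp only [dotProduct, Matrix.mulVec, Params.siMatrix, Matrix.conjTranspose_apply,
      Matrix.of_apply, Pi.star_apply, star_sum, ← Finset.mul_sum, ← Finset.sum_mul]
    ring
  rw [h1, norm_mul, norm_mul, norm_star, norm_star, mul_pow, mul_pow, beamGain, beamGain]

/-- For constant self-interference coefficients the SINR threshold is affine in the product of the
two beamforming gains. A zero channel vector is no exception: its beamforming gain is `0`, through
`beam h = 0`. -/
theorem outage_iff (S : Params) (hpRF : 0 ≤ S.pRF) (hpU : 0 < S.pU) (hφur : 0 < S.φur)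
    (hφSI : 0 ≤ S.φSI) (hζ : 0 ≤ S.ζ) (hκ : S.κ < 1) (hσ : 0 < S.σ) {M N : ℕ}
    (htd : Fin M → ℂ) (hur : Fin N → ℂ) :
    S.Outage (S.harvestedPower 1) htd hur ↔
      normSq hur < S.a₄ * (beamGain hur * beamGain htd) + S.b₄ := by
  have h1κ : 0 < 1 - S.κ := by linarith
  set q := beamGain hur * beamGain htd with hq
  have hq0 : 0 ≤ q := mul_nonneg (beamGain_nonneg _) (beamGain_nonneg _)
  have hG := normSq_nonneg hur
  have hpow : S.harvestedPower 1 + S.pRF = S.pRF / (1 - S.κ) := by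
    rw [Params.harvestedPower]
    field_simp
    ring
  set D : ℝ := S.φSI * (S.pRF / (1 - S.κ)) * S.ζ * (‖S.gs‖ ^ 2 * q) + S.σ ^ 2 with hD
  have hD0 : 0 < D := by positivity
  have hsinr : S.sinr (S.harvestedPower 1) htd hur = S.φur * S.pU * normSq hur / D := by
    rw [Params.sinr, hpow, norm_sq_selfInterference]
  have hs0 : 0 ≤ S.φur * S.pU * normSq hur / D := by positivity
  have hthr : S.a₄ * q + S.b₄ = ((2 : ℝ) ^ S.rate - 1) * D / (S.φur * S.pU) := by
    rw [Params.a₄, Params.b₄, hD]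
    field_simp
  rw [Params.Outage, hsinr, Real.logb_lt_iff_lt_rpow one_lt_two (by linarith),
    hthr, lt_div_iff₀ (by positivity), ← lt_sub_iff_add_lt', div_lt_iff₀ hD0,
    mul_comm (normSq hur)]

/-- The joint law of the two channel vectors. -/
theorem map_channels_eq_prod {Ω : Type*} [MeasurableSpace Ω] {μ : Measure Ω}
    [IsProbabilityMeasure μ] {M N : ℕ} {htd : Fin M → Ω → ℂ} {hur : Fin N → Ω → ℂ}
    (htd_meas : ∀ j, Measurable (htd j)) (hur_meas : ∀ i, Measurable (hur i))
    (htd_law : ∀ j, μ.map (htd j) = stdComplexGaussian)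
    (hur_law : ∀ i, μ.map (hur i) = stdComplexGaussian)
    (hindep : iIndepFun (Sum.elim htd hur) μ) :
    μ.map (fun ω => ((fun j => htd j ω, fun i => hur i ω) : (Fin M → ℂ) × (Fin N → ℂ))) =
      (gaussianVector M).prod (gaussianVector N) := by
  have hmeas : ∀ i, Measurable (Sum.elim htd hur i) := by
    rintro (j | i)
    exacts [htd_meas j, hur_meas i]
  have h1 := (iIndepFun_iff_map_fun_eq_pi_map fun i => (hmeas i).aemeasurable).1 hindep
  have h2 : (fun i => μ.map (Sum.elim htd hur i)) = fun _ => stdComplexGaussian := by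
    funext i
    rcases i with j | i
    exacts [htd_law j, hur_law i]
  rw [h2] at h1
  have h3 := measurePreserving_sumPiEquivProdPi
    (fun _ : Fin M ⊕ Fin N => stdComplexGaussian)
  rw [gaussianVector, gaussianVector, ← h3.map_eq, ← h1, Measure.map_map h3.measurable
    (measurable_pi_lambda _ hmeas)]
  rfl

/-- The probability of the complement of the outage event. -/
theorem measureReal_coverage {Ω : Type*} [MeasurableSpace Ω] {μ : Measure Ω}
    [IsProbabilityMeasure μ] {m k : ℕ} {htd : Fin (m + 2) → Ω → ℂ} {hur : Fin (k + 2) → Ω → ℂ}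
    (htd_meas : ∀ j, Measurable (htd j)) (hur_meas : ∀ i, Measurable (hur i))
    (htd_law : ∀ j, μ.map (htd j) = stdComplexGaussian)
    (hur_law : ∀ i, μ.map (hur i) = stdComplexGaussian)
    (hindep : iIndepFun (Sum.elim htd hur) μ) {a b : ℝ} (ha : 0 ≤ a) (hb : 0 ≤ b) :
    μ.real {ω | a * (beamGain (fun i => hur i ω) * beamGain fun j => htd j ω) + b ≤
        normSq fun i => hur i ω} =
      beta ((m : ℝ) + 1) ((k : ℝ) + 1) *
        ∑ i ∈ Finset.range (k + 2), ∑ l ∈ Finset.range (i + 1), ∑ p ∈ Finset.range (m + k + 2),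
          outageCoeff a b (m + 2) (k + 2) i l p *
            ∫ u in Set.Ioi (0 : ℝ), integrand a (m + 2) (k + 2) i l p u := by
  set T : Set ((Fin (m + 2) → ℂ) × (Fin (k + 2) → ℂ)) :=
    {p | a * (beamGain p.2 * beamGain p.1) + b ≤ normSq p.2} with hT
  have hTm : MeasurableSet T := measurableSet_le (by fun_prop) (by fun_prop)
  have hpair : Measurable
      (fun ω => ((fun j => htd j ω, fun i => hur i ω) : (Fin (m + 2) → ℂ) × (Fin (k + 2) → ℂ))) :=
    (measurable_pi_lambda _ htd_meas).prodMk (measurable_pi_lambda _ hur_meas)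
  have hμ : μ {ω | a * (beamGain (fun i => hur i ω) * beamGain fun j => htd j ω) + b ≤
      normSq fun i => hur i ω} =
      ∫⁻ x, ∫⁻ h, (Set.Ici (a * (beamGain h * beamGain x) + b)).indicator 1 (normSq h)
        ∂gaussianVector (k + 2) ∂gaussianVector (m + 2) := by
    have h1 : μ.map (fun ω => ((fun j => htd j ω, fun i => hur i ω) :
        (Fin (m + 2) → ℂ) × (Fin (k + 2) → ℂ))) T =
        (gaussianVector (m + 2)).prod (gaussianVector (k + 2)) T := by
      rw [map_channels_eq_prod htd_meas hur_meas htd_law hur_law hindep]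
    rw [Measure.map_apply hpair hTm] at h1
    refine h1.trans ?_
    rw [← lintegral_indicator_one hTm, lintegral_prod _ (measurable_one.indicator hTm).aemeasurable]
    refine lintegral_congr fun x => lintegral_congr fun h => ?_
    simp [Set.indicator_apply, hT]
  rw [measureReal_def, hμ, lintegral_coverage k m ha hb, ← integral_coverage ha b k m,
    ← integral_eq_lintegral_of_nonneg_ae]
  · filter_upwards [ae_restrict_mem measurableSet_Ioi] with u hu
    have hu0 : (0 : ℝ) < u := hu
    have hE := eulerIntegral_nonneg k m (by linarith : -u < 1)
    have hΓ := gammaTail_nonneg (k + 1)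
      (show 0 ≤ a * (m + 2) * (k + 2) / (1 + u) + b by positivity)
    show 0 ≤ (m + 1) * (k + 1) * (u ^ (m + k + 1) / (1 + u) ^ (m + 2) * eulerIntegral k m (-u)) *
      gammaTail (k + 1) (a * (m + 2) * (k + 2) / (1 + u) + b)
    positivity
  · refine ContinuousOn.aestronglyMeasurable ?_ measurableSet_Ioi
    have hpos : ∀ u ∈ Set.Ioi (0 : ℝ), 1 + u ≠ 0 := fun u hu => by
      have hu0 : (0 : ℝ) < u := hu
      positivity
    have hE : ContinuousOn (fun u => eulerIntegral k m (-u)) (Set.Ioi 0) :=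
      (analyticOnNhd_eulerIntegral k m).continuousOn.comp continuousOn_neg fun u hu => by
        have hu0 : (0 : ℝ) < u := hu
        show -u < 1
        linarith
    have hlin : ContinuousOn (fun u : ℝ => 1 + u) (Set.Ioi 0) := by fun_prop
    exact (continuousOn_const.mul (((continuousOn_pow _).div (hlin.pow _)
      fun u hu => pow_ne_zero _ (hpos u hu)).mul hE)).mul
      ((continuous_gammaTail _).comp_continuousOn
        ((continuousOn_const.div hlin hpos).add continuousOn_const))

end FullDuplex

theorem theorem4 {Ω : Type*} [MeasurableSpace Ω] (μ : Measure Ω) [IsProbabilityMeasure μ]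
    (S : FullDuplex.Params)
    (hpRF : 0 ≤ S.pRF) (hpU : 0 < S.pU) (hφur : 0 < S.φur) (hφSI : 0 ≤ S.φSI) (hφg : 0 ≤ S.φg)
    (hζ : 0 ≤ S.ζ) (hη : 0 ≤ S.η) (hκ : S.κ < 1) (hσ : 0 < S.σ) (hrate : 0 < S.rate)
    (M N n : ℕ) (hM : 2 ≤ M) (hN : 2 ≤ N) (hn : 1 ≤ n)
    (htd : Fin M → Ω → ℂ) (hur : Fin N → Ω → ℂ)
    (htd_meas : ∀ j, Measurable (htd j)) (hur_meas : ∀ i, Measurable (hur i))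
    (htd_law : ∀ j, μ.map (htd j) = FullDuplex.stdComplexGaussian)
    (hur_law : ∀ i, μ.map (hur i) = FullDuplex.stdComplexGaussian)
    (hindep : iIndepFun (Sum.elim htd hur) μ) :
    (FullDuplex.laguerreNodes n).card = n ∧
    ∃ ξ : ℕ → ℕ → ℕ → ℝ,
      (∀ i < N, ∀ l ≤ i, ∀ p ≤ M + N - 3,
        0 < ξ i l p ∧
        IntegrableOn (FullDuplex.integrand S.a₄ M N i l p) (Set.Ioi 0) ∧
        ContDiffOn ℝ ((2 * n : ℕ) : WithTop ℕ∞)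
          (FullDuplex.weightedIntegrand S.a₄ M N i l p) (Set.Ioi 0) ∧
        ∫ u in Set.Ioi (0 : ℝ), FullDuplex.integrand S.a₄ M N i l p u =
          FullDuplex.gaussLaguerreSum n (FullDuplex.weightedIntegrand S.a₄ M N i l p) +
          FullDuplex.gaussLaguerreRemainder n
            (FullDuplex.weightedIntegrand S.a₄ M N i l p) (ξ i l p)) ∧
      -- the outage probability, the loop gain in the harvested power being replaced by `1`
      μ.real {ω | S.Outage (S.harvestedPower 1) (fun j => htd j ω) (fun i => hur i ω)} =
        1 - ProbabilityTheory.beta ((M : ℝ) - 1) ((N : ℝ) - 1) *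
          ∑ i ∈ Finset.range N, ∑ l ∈ Finset.range (i + 1), ∑ p ∈ Finset.range (M + N - 2),
            S.b₄ ^ l * S.a₄ ^ (i - l) * ((M : ℝ) - 1) * ((N : ℝ) - 1) /
                ((i.factorial : ℝ) * Real.exp S.b₄) *
              (-1) ^ p * ((M + N - 3).choose p : ℝ) * (i.choose l : ℝ) *
              ((M : ℝ) * N) ^ (i - l) *
              (FullDuplex.gaussLaguerreSum n (FullDuplex.weightedIntegrand S.a₄ M N i l p) +
                FullDuplex.gaussLaguerreRemainder n
                  (FullDuplex.weightedIntegrand S.a₄ M N i l p) (ξ i l p)) ∧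
      -- without recycling (`κ = 0`) the replacement changes nothing
      (S.κ = 0 →
        {ω | S.Outage (S.harvestedPower (FullDuplex.beamGain fun j => htd j ω))
            (fun j => htd j ω) (fun i => hur i ω)} =
          {ω | S.Outage (S.harvestedPower 1) (fun j => htd j ω) (fun i => hur i ω)}) := by
  open FullDuplex in
  obtain ⟨m, rfl⟩ := Nat.exists_eq_add_of_le' hM
  obtain ⟨k, rfl⟩ := Nat.exists_eq_add_of_le' hN
  have h1κ : 0 < 1 - S.κ := by linarith
  have hpow : 0 ≤ (2 : ℝ) ^ S.rate - 1 := by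
    have := Real.one_le_rpow (one_le_two (α := ℝ)) hrate.le
    linarith
  have ha : 0 ≤ S.a₄ := by
    rw [Params.a₄]
    positivity
  have hb : 0 ≤ S.b₄ := by
    rw [Params.b₄]
    positivity
  have hweight : ∀ i l p, (fun u => Real.exp (-u) *
      weightedIntegrand S.a₄ (m + 2) (k + 2) i l p u) =
        integrand S.a₄ (m + 2) (k + 2) i l p := fun i l p => by
    funext u
    rw [weightedIntegrand, ← mul_assoc, ← Real.exp_add, neg_add_cancel, Real.exp_zero, one_mul]
  have hquad : ∀ i l p, ∃ ξ : ℝ, l ≤ i → 0 < ξ ∧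
      ∫ u in Set.Ioi (0 : ℝ), integrand S.a₄ (m + 2) (k + 2) i l p u =
        gaussLaguerreSum n (weightedIntegrand S.a₄ (m + 2) (k + 2) i l p) +
          gaussLaguerreRemainder n (weightedIntegrand S.a₄ (m + 2) (k + 2) i l p) ξ := by
    intro i l p
    by_cases hli : l ≤ i
    · have hint := integrableOn_integrand ha k m hli p
      rw [← hweight] at hint
      obtain ⟨ξ, hξ, h⟩ := exists_gaussLaguerre_remainder hn
        (contDiffOn_weightedIntegrand S.a₄ k m i l p _) hint
      refine ⟨ξ, fun _ => ⟨hξ, ?_⟩⟩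
      rw [← h, hweight]
    · exact ⟨0, fun h => absurd h hli⟩
  choose ξ hξ using hquad
  refine ⟨card_laguerreNodes n, ξ, fun i _ l hli p _ => ⟨(hξ i l p hli).1,
    integrableOn_integrand ha k m hli p, contDiffOn_weightedIntegrand S.a₄ k m i l p _,
    (hξ i l p hli).2⟩, ?_, fun hκ0 => ?_⟩
  · have hset : {ω | S.Outage (S.harvestedPower 1) (fun j => htd j ω) (fun i => hur i ω)} =
        {ω | S.a₄ * (beamGain (fun i => hur i ω) * beamGain fun j => htd j ω) + S.b₄ ≤
          normSq fun i => hur i ω}ᶜ := by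
      ext ω
      simp only [Set.mem_ofPred_eq, Set.mem_compl_iff, not_le,
        outage_iff S hpRF hpU hφur hφSI hζ hκ hσ]
    have hmeas : MeasurableSet {ω | S.a₄ * (beamGain (fun i => hur i ω) *
        beamGain fun j => htd j ω) + S.b₄ ≤ normSq fun i => hur i ω} := by
      have h1 : Measurable fun ω => (fun j => htd j ω) := measurable_pi_lambda _ htd_meas
      have h2 : Measurable fun ω => (fun i => hur i ω) := measurable_pi_lambda _ hur_meas
      exact measurableSet_le (by fun_prop) (by fun_prop)
    rw [hset, probReal_compl_eq_one_sub hmeas,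
      measureReal_coverage htd_meas hur_meas htd_law hur_law hindep ha hb,
      show m + 2 + (k + 2) - 2 = m + k + 2 by omega,
      show ((m + 2 : ℕ) : ℝ) - 1 = m + 1 by push_cast; ring,
      show ((k + 2 : ℕ) : ℝ) - 1 = k + 1 by push_cast; ring]
    congr 2
    refine Finset.sum_congr rfl fun i _ => Finset.sum_congr rfl fun l hl =>
      Finset.sum_congr rfl fun p _ => ?_
    rw [(hξ i l p (Nat.lt_succ_iff.1 (Finset.mem_range.1 hl))).2, outageCoeff,
      show ((m + 2 : ℕ) : ℝ) - 1 = m + 1 by push_cast; ring,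
      show ((k + 2 : ℕ) : ℝ) - 1 = k + 1 by push_cast; ring]
  · simp only [Params.harvestedPower, hκ0, zero_mul, zero_div]
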